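/- Let $(\Omega,\mathcal F,\mathsf P)$ be a probability space with a nondecreasing family of $\sigma$-algebras $\mathcal F_\tau\subset\mathcal F$, $\tau\in[0,T]$, and let $0\le t<T$. Let $\mathbf f^{(1)},\dots,\mathbf f^{(m)}$ be independent standard Wiener processes on $[0,T]$, each adapted to $(\mathcal F_\tau)$ and such that $\mathbf f^{(i)}_u-\mathbf f^{(i)}_s$ is independent of $\mathcal F_s$ for $s<u$; put $\mathbf w^{(i)}_\tau=\mathbf f^{(i)}_\tau$ for $i=1,\dots,m$ and $\mathbf w^{(0)}_\tau=\tau$. Let $k\ge 2$ and $i_1,\dots,i_k\in\{0,1,\dots,m\}$. Let $\xi=(\xi_\tau)_{\tau\in[t,T]}$ belong to $S_2([t,T])$: $\xi$ is jointly measurable in $(\tau,\omega)$, adapted to $(\mathcal F_\tau)$, satisfies $\int_t^T\mathsf M\{\xi_\tau^2\}\,d\tau<\infty$ and $\mathsf M\{\xi_\tau^2\}<\infty$ for every $\tau\in[t,T]$, and is mean-square continuous on $[t,T]$. Let $\Phi(t_1,\dots,t_{k-1})$ be a continuous nonrandom function on the closed simplex $\{(t_1,\dots,t_{k-1}):\ t\le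 t_{k-1}\le\dots\le t_2\le t_1\le T\}$. Consider the iterated Ito integral $$J[\xi,\Phi]^{(k)}_{T,t}=\int_t^T\int_t^{t_1}\cdots\int_t^{t_{k-1}}\Phi(t_1,\dots,t_{k-1})\,\xi_{t_k}\,d\mathbf w^{(i_k)}_{t_k}\cdots d\mathbf w^{(i_2)}_{t_2}\,d\mathbf w^{(i_1)}_{t_1}.$$ For partitions $\tau_0<\tau_1<\dots<\tau_N$ of an interval, write $\Delta\mathbf w^{(i)}_{\tau_l}=\mathbf w^{(i)}_{\tau_{l+1}}-\mathbf w^{(i)}_{\tau_l}$. For $s\in[t,T]$ define the order-replaced integrals of a continuous nonrandom kernel $\Psi$ of $r$ variables on $\{s\le t_r\le\dots\le t_1\le T\}$ recursively by $$\tilde J[\Psi]^{(1)}_{T,s}=\int_s^T\Psi(t_1)\,d\mathbf w^{(i_1)}_{t_1}\quad\text{(an Ito integral)},\qquad \tilde J[\Psi]^{(r)}_{T,s}=\mathop{\mathrm{l.i.m.}}\sum_{l=0}^{N-1}\Delta\mathbf w^{(i_r)}_{\tau_l}\,\tilde J[\Psi(\cdot,\dots,\cdot,\tau_l)]^{(r-1)}_{T,\tau_{l+1}}\quad(r\ge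 2),$$ the mean-square limit being taken over partitions $s=\tau_0<\dots<\tau_N=T$ along every sequence of partitions whose mesh tends to $0$, and put, with partitions $t=\tau_0<\dots<\tau_N=T$ and the same kind of limit, $$\hat J[\xi,\Phi]^{(k)}_{T,t}=\mathop{\mathrm{l.i.m.}}\sum_{l=0}^{N-1}\xi_{\tau_l}\,\Delta\mathbf w^{(i_k)}_{\tau_l}\,\tilde J[\Phi]^{(k-1)}_{T,\tau_{l+1}}.$$ Then the integrals $J[\xi,\Phi]^{(k)}_{T,t}$ and $\hat J[\xi,\Phi]^{(k)}_{T,t}$ exist (all the limits in the definition of $\hat J$ exist), and $$J[\xi,\Phi]^{(k)}_{T,t}=\hat J[\xi,\Phi]^{(k)}_{T,t}\quad\text{almost surely.}$$ -/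

import Mathlib

open MeasureTheory ProbabilityTheory Filter Set
open scoped Topology ENNReal NNReal

noncomputable section

namespace IterIto

variable {Ω : Type*} {mΩ : MeasurableSpace Ω}

/-! ### Wiener processes on `[0, T]` and the integrators -/

/-- `f` is a standard Wiener process on `[0, T]` relative to the filtration `𝓕`: it is adapted,
starts at `0`, its increment over `[s, u]` is independent of `𝓕 s` with law `N(0, u - s)`, and its
paths are almost surely continuous on `[0, T]`.  (Independence of the increments of `f` among
themselves follows from `adapted` and `indep`.)  Only times in `[0, T]` matter. -/
structure IsWiener (P : Measure Ω) (𝓕 : Filtration ℝ mΩ) (T : ℝ) (f : ℝ → Ω → ℝ) : Prop where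
  adapted : ∀ s ∈ Icc 0 T, Measurable[𝓕 s] (f s)
  zero : ∀ᵐ ω ∂P, f 0 ω = 0
  indep : ∀ s u, 0 ≤ s → s < u → u ≤ T →
    Indep (MeasurableSpace.comap (fun ω => f u ω - f s ω) inferInstance) (𝓕 s) P
  law : ∀ s u, 0 ≤ s → s < u → u ≤ T →
    HasLaw (fun ω => f u ω - f s ω) (gaussianReal 0 (Real.toNNReal (u - s))) P
  cont : ∀ᵐ ω ∂P, ContinuousOn (fun s => f s ω) (Icc 0 T)

/-- The integrators: number `0` is time, number `i ≥ 1` is the `i`-th Wiener process. -/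
def integrator {m : ℕ} (f : Fin m → ℝ → Ω → ℝ) (i : Fin (m + 1)) : ℝ → Ω → ℝ :=
  Fin.cases (fun s _ => s) f i

/-! ### The classes of integrands -/

/-- The class `M₂([a, b])`: jointly measurable, adapted, square integrable on `[a, b] × Ω`, and
square integrable at every time.  (The independence of `ξ τ` from the increments of the Wiener
processes after time `τ` follows from adaptedness, as these increments are independent of `𝓕 τ`.) -/
structure MemM2 (P : Measure Ω) (𝓕 : Filtration ℝ mΩ) (a b : ℝ) (ξ : ℝ → Ω → ℝ) : Prop where
  measurable : Measurable (fun p : Icc a b × Ω => ξ p.1 p.2)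
  adapted : ∀ s ∈ Icc a b, Measurable[𝓕 s] (ξ s)
  sq_integrable : ∫⁻ s in Icc a b, ∫⁻ ω, ‖ξ s ω‖ₑ ^ 2 ∂P < ∞
  memLp : ∀ s ∈ Icc a b, MemLp (ξ s) 2 P

/-- The class `S₂([a, b])`: the mean-square continuous members of `M₂([a, b])`. -/
structure MemS2 (P : Measure Ω) (𝓕 : Filtration ℝ mΩ) (a b : ℝ) (ξ : ℝ → Ω → ℝ) : Prop
    extends MemM2 P 𝓕 a b ξ where
  ms_continuous : ∀ s ∈ Icc a b,
    Tendsto (fun r => eLpNorm (fun ω => ξ r ω - ξ s ω) 2 P) (𝓝[Icc a b] s) (𝓝 0)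

/-! ### Partitions and limits in the mean along partitions -/

/-- A finite partition `a = τ₀ < τ₁ < ⋯ < τ_N = b`.  (If `a = b`, then `N = 0`.) -/
structure Partition (a b : ℝ) where
  N : ℕ
  pt : ℕ → ℝ
  pt_zero : pt 0 = a
  pt_last : pt N = b
  pt_lt : ∀ j < N, pt j < pt (j + 1)

/-- The largest step `max_j (τ_{j+1} - τ_j)` of a partition. -/
def Partition.mesh {a b : ℝ} (π : Partition a b) : ℝ≥0 :=
  (Finset.range π.N).sup fun j => Real.toNNReal (π.pt (j + 1) - π.pt j)

/-- `X` is the mean-square limit of `S π` as the mesh of the partition `π` of `[a, b]` tends to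
zero, along every sequence of such partitions. -/
def IsMeanSquareLimit (P : Measure Ω) {a b : ℝ} (S : Partition a b → Ω → ℝ) (X : Ω → ℝ) : Prop :=
  MemLp X 2 P ∧ ∀ π : ℕ → Partition a b, Tendsto (fun n => (π n).mesh) atTop (𝓝 0) →
    Tendsto (fun n => eLpNorm (fun ω => S (π n) ω - X ω) 2 P) atTop (𝓝 0)

/-! ### The Ito integral -/

/-- The step process with value `c j` on `[τ_j, τ_{j+1})`. -/
def stepFun {a b : ℝ} (π : Partition a b) (c : ℕ → Ω → ℝ) (s : ℝ) (ω : Ω) : ℝ :=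
  ∑ j ∈ Finset.range π.N, (Ico (π.pt j) (π.pt (j + 1))).indicator (fun _ => c j ω) s

/-- `X` is (a version of) the integral `∫_a^b ξ_τ dw_τ` of `ξ ∈ M₂([a, b])` against `w`, where `w`
is a Wiener process or `w_τ = τ`: the mean-square limit of the sums `∑ c_j (w_{τ_{j+1}} - w_{τ_j})`
for adapted square integrable step processes that converge to `ξ` in `L²([a, b] × Ω)`.  The limit
does not depend, up to almost sure equality, on the choice of the step processes. -/
def IsItoIntegral (P : Measure Ω) (𝓕 : Filtration ℝ mΩ) (w : ℝ → Ω → ℝ) (a b : ℝ)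
    (ξ : ℝ → Ω → ℝ) (X : Ω → ℝ) : Prop :=
  MemM2 P 𝓕 a b ξ ∧ MemLp X 2 P ∧
  ∃ (π : ℕ → Partition a b) (c : ℕ → ℕ → Ω → ℝ),
    (∀ n, ∀ j < (π n).N, Measurable[𝓕 ((π n).pt j)] (c n j) ∧ MemLp (c n j) 2 P) ∧
    Tendsto (fun n => ∫⁻ s in Icc a b, ∫⁻ ω, ‖stepFun (π n) (c n) s ω - ξ s ω‖ₑ ^ 2 ∂P)
      atTop (𝓝 0) ∧
    Tendsto (fun n => eLpNorm (fun ω => ∑ j ∈ Finset.range (π n).N,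
      c n j ω * (w ((π n).pt (j + 1)) ω - w ((π n).pt j) ω) - X ω) 2 P) atTop (𝓝 0)

/-! ### The iterated integrals

Kernels have the variables `v 0 = t₁`, `v 1 = t₂`, and so on, with `t₁ ≥ t₂ ≥ ⋯`; the integrator
of the variable `t_{j+1}` has the number `i j`. -/

/-- The closed simplex `{(t₁, …, t_n) : T ≥ t₁ ≥ t₂ ≥ ⋯ ≥ t_n ≥ t}`. -/
def simplex (n : ℕ) (t T : ℝ) : Set (Fin n → ℝ) :=
  {v | Antitone v ∧ ∀ j, v j ∈ Icc t T}

/-- `X` is (a version of) the iterated Ito integral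
`∫_t^s ∫_t^{t₁} ⋯ ∫_t^{t_n} Φ(t₁, …, t_n) ξ_{t_{n+1}} dw_{t_{n+1}}^{(i_{n+1})} ⋯ dw_{t₁}^{(i₁)}`.
The outermost integrand is a process `Y ∈ M₂([t, s])` whose value at each `r = t₁` is a version of
the remaining `n`-fold integral over `[t, r]`. -/
def IsIteratedIto (P : Measure Ω) (𝓕 : Filtration ℝ mΩ) {m : ℕ} (w : Fin (m + 1) → ℝ → Ω → ℝ)
    (ξ : ℝ → Ω → ℝ) (t : ℝ) :
    (n : ℕ) → (Fin (n + 1) → Fin (m + 1)) → ((Fin n → ℝ) → ℝ) → ℝ → (Ω → ℝ) → Prop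
  | 0, i, Φ, s, X => IsItoIntegral P 𝓕 (w (i 0)) t s (fun r ω => Φ Fin.elim0 * ξ r ω) X
  | n + 1, i, Φ, s, X => ∃ Y : ℝ → Ω → ℝ,
      (∀ r ∈ Icc t s,
        IsIteratedIto P 𝓕 w ξ t n (Fin.tail i) (fun v => Φ (Fin.cons r v)) r (Y r)) ∧
      IsItoIntegral P 𝓕 (w (i 0)) t s Y X

/-- `X` is (a version of) the order-replaced integral of the nonrandom kernel `Φ` of `n + 1`
variables,
`∫_s^T dw_{t_{n+1}}^{(i_{n+1})} ∫_{t_{n+1}}^T dw_{t_n}^{(i_n)} ⋯ ∫_{t₂}^T Φ(t₁, …, t_{n+1}) dw_{t₁}^{(i₁)}`.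
For one variable it is an Ito integral over `[s, T]`.  For more variables it is the mean-square
limit of the sums over `l` of `(w_{τ_{l+1}} - w_{τ_l}) * Y τ_l τ_{l+1}`, with `w` the integrator of
`t_{n+1}` and with `Y r u` a version of the order-replaced integral over `[u, T]` of the kernel with
its last variable `t_{n+1}` frozen at `r ≤ u`. -/
def IsOrderReplaced (P : Measure Ω) (𝓕 : Filtration ℝ mΩ) {m : ℕ} (w : Fin (m + 1) → ℝ → Ω → ℝ)
    (T : ℝ) :
    (n : ℕ) → (Fin (n + 1) → Fin (m + 1)) → ((Fin (n + 1) → ℝ) → ℝ) → ℝ → (Ω → ℝ) → Prop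
  | 0, i, Φ, s, X => IsItoIntegral P 𝓕 (w (i 0)) s T (fun r _ => Φ (fun _ => r)) X
  | n + 1, i, Φ, s, X => ∃ Y : ℝ → ℝ → Ω → ℝ,
      (∀ r u, s ≤ r → r ≤ u → u ≤ T →
        IsOrderReplaced P 𝓕 w T n (Fin.init i) (fun v => Φ (Fin.snoc v r)) u (Y r u)) ∧
      IsMeanSquareLimit P (fun (π : Partition s T) ω => ∑ l ∈ Finset.range π.N,
        (w (i (Fin.last (n + 1))) (π.pt (l + 1)) ω - w (i (Fin.last (n + 1))) (π.pt l) ω) *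
          Y (π.pt l) (π.pt (l + 1)) ω) X

/-- `X` is (a version of) the order-replaced integral with the random process `ξ`,
`∫_t^T ξ_{t_{n+2}} dw_{t_{n+2}}^{(i_{n+2})} ∫_{t_{n+2}}^T dw_{t_{n+1}}^{(i_{n+1})} ⋯
  ∫_{t₂}^T Φ(t₁, …, t_{n+1}) dw_{t₁}^{(i₁)}`:
the mean-square limit of the sums over `l` of `ξ_{τ_l} * (w_{τ_{l+1}} - w_{τ_l}) * Y τ_{l+1}`, with
`w` the integrator of `t_{n+2}` and with `Y u` a version of the order-replaced integral of `Φ` over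
`[u, T]`. -/
def IsOrderReplacedWith (P : Measure Ω) (𝓕 : Filtration ℝ mΩ) {m : ℕ}
    (w : Fin (m + 1) → ℝ → Ω → ℝ) (ξ : ℝ → Ω → ℝ) (t T : ℝ) (n : ℕ)
    (i : Fin (n + 2) → Fin (m + 1)) (Φ : (Fin (n + 1) → ℝ) → ℝ) (X : Ω → ℝ) : Prop :=
  ∃ Y : ℝ → Ω → ℝ,
    (∀ u ∈ Icc t T, IsOrderReplaced P 𝓕 w T n (Fin.init i) Φ u (Y u)) ∧
    IsMeanSquareLimit P (fun (π : Partition t T) ω => ∑ l ∈ Finset.range π.N,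
      ξ (π.pt l) ω *
        (w (i (Fin.last (n + 1))) (π.pt (l + 1)) ω - w (i (Fin.last (n + 1))) (π.pt l) ω) *
          Y (π.pt (l + 1)) ω) X

end IterIto

end

noncomputable section

namespace IterIto

variable {Ω : Type*} {mΩ : MeasurableSpace Ω}

/-! ### Elementary integrals and their uniform closure -/

/-! Both integrals are identified with one object, the iterated integral `iter` of the `L²`-valued
kernel `Φ(t₁, …, t_{k-1}) ξ_{t_k}`, so existence and almost sure equality follow together.

The analysis is a single inequality: for every integrator, Wiener or time, the square of the `L²`
norm of an elementary integral is at most `C` times the time integral of the squared norm of the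
integrand (`IsL2Integrator`). It comes from the Ito isometry for a Wiener process and from
Cauchy–Schwarz for time. It survives uniform closure (`itoGraph`), and all integrands that occur are
mean-square continuous on a compact set, so uniform approximation by steps suffices.

`iter` integrates the innermost variable first, over `[u, t_{r-1}]` with the other variables as
parameters; the result is again a continuous adapted kernel (`IsKernel.ito`). On the Ito side the
outermost integral can be split off instead (`iter_succ`), which matches the recursive definition
and gives `isIteratedIto_iff`.

On the order-replaced side, a summand is `ξ_{τ_l} Δw_{τ_l}` times an iterated integral over
`[τ_{l+1}, T]`. The factor belongs to the past of `τ_{l+1}`, so it moves inside the integral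
(`IsKernel.iter_ae_eq_mul`). For fixed outer variables, the kernels with `τ_{l+1} ≤ t_{r-1}` then
add up to a Riemann–Ito sum for the innermost integral of `iter`, with an error small uniformly in
the outer variables. The remaining integrations enlarge the error only by a constant factor
(`norm_sum_iter_sub_le`). This is `tendsto_sum_iter`; applied at each level of the recursion it
gives `isOrderReplaced_iff` and `isOrderReplacedWith_iff`. -/

/-- The class of `c * (w b - w a)`, or `0` if that is not square integrable. -/
def increment (P : Measure Ω) (w : ℝ → Ω → ℝ) (a b : ℝ) (c : Lp ℝ 2 P) : Lp ℝ 2 P :=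
  open Classical in
  if h : MemLp (fun ω => c ω * (w b ω - w a ω)) 2 P then h.toLp else 0

/-- The span of the pairs of a one-step adapted process and its integral. -/
def elementary (P : Measure Ω) (𝓕 : Filtration ℝ mΩ) (T : ℝ) (w : ℝ → Ω → ℝ) :
    Submodule ℝ ((ℝ → Lp ℝ 2 P) × Lp ℝ 2 P) :=
  Submodule.span ℝ {p | ∃ a b c, 0 ≤ a ∧ a ≤ b ∧ b ≤ T ∧ c ∈ lpMeas ℝ ℝ (𝓕 a) 2 P ∧
    p = ((Ico a b).indicator (fun _ => c), increment P w a b c)}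

/-- An integrator on `[0, T]` whose elementary integrals are bounded in mean square by the
`L²([0, T] × Ω)` norm of the integrand, with constant `C`. -/
structure IsL2Integrator (P : Measure Ω) (𝓕 : Filtration ℝ mΩ) (T : ℝ) (C : ℝ≥0)
    (w : ℝ → Ω → ℝ) : Prop where
  measurable : ∀ a b, 0 ≤ a → a ≤ b → b ≤ T → Measurable[𝓕 b] (fun ω => w b ω - w a ω)
  memLp : ∀ a b, 0 ≤ a → a ≤ b → b ≤ T → ∀ c ∈ lpMeas ℝ ℝ (𝓕 a) 2 P,
    MemLp (fun ω => c ω * (w b ω - w a ω)) 2 P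
  bound : ∀ p ∈ elementary P 𝓕 T w, ‖p.2‖ₑ ^ 2 ≤ C * ∫⁻ s in Ico 0 T, ‖p.1 s‖ₑ ^ 2

/-- The closure of the graph of the elementary integral with respect to uniform convergence of the
integrands on `[0, T)`. -/
def itoGraph (P : Measure Ω) (𝓕 : Filtration ℝ mΩ) (T : ℝ) (w : ℝ → Ω → ℝ) :
    Submodule ℝ ((ℝ → Lp ℝ 2 P) × Lp ℝ 2 P) where
  carrier := {p | ∀ ε > 0, ∃ q ∈ elementary P 𝓕 T w,
    (∀ s ∈ Ico 0 T, ‖p.1 s - q.1 s‖ ≤ ε) ∧ ‖p.2 - q.2‖ ≤ ε}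
  add_mem' := by
    intro p p' hp hp' ε hε
    obtain ⟨q, hq, h1, h2⟩ := hp (ε / 2) (half_pos hε)
    obtain ⟨q', hq', h1', h2'⟩ := hp' (ε / 2) (half_pos hε)
    refine ⟨q + q', add_mem hq hq', fun s hs => ?_, ?_⟩
    · have : (p + p').1 s - (q + q').1 s = (p.1 s - q.1 s) + (p'.1 s - q'.1 s) := by
        simp only [Prod.fst_add, Pi.add_apply]; abel
      rw [this]
      exact (norm_add_le _ _).trans (by linarith [h1 s hs, h1' s hs])
    · have : (p + p').2 - (q + q').2 = (p.2 - q.2) + (p'.2 - q'.2) := by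
        simp only [Prod.snd_add]; abel
      rw [this]
      exact (norm_add_le _ _).trans (by linarith)
  zero_mem' := fun ε hε => ⟨0, zero_mem _, by simp [hε.le], by simp [hε.le]⟩
  smul_mem' := by
    intro r p hp ε hε
    -- The added `1` keeps the divisor positive when `r = 0`.
    have hr : 0 < |r| + 1 := by positivity
    obtain ⟨q, hq, h1, h2⟩ := hp (ε / (|r| + 1)) (by positivity)
    have key : ∀ z : Lp ℝ 2 P, ‖z‖ ≤ ε / (|r| + 1) → ‖r • z‖ ≤ ε := fun z hz => by
      rw [norm_smul, Real.norm_eq_abs]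
      calc |r| * ‖z‖ ≤ (|r| + 1) * (ε / (|r| + 1)) := by gcongr; linarith
        _ = ε := by field_simp
    refine ⟨r • q, Submodule.smul_mem _ _ hq, fun s hs => ?_, ?_⟩
    · simpa only [Prod.smul_fst, Pi.smul_apply, ← smul_sub] using key _ (h1 s hs)
    · simpa only [Prod.smul_snd, ← smul_sub] using key _ h2

section Graph

variable {P : Measure Ω} {𝓕 : Filtration ℝ mΩ} {T : ℝ} {C : ℝ≥0} {w : ℝ → Ω → ℝ}

lemma elementary_le_itoGraph : elementary P 𝓕 T w ≤ itoGraph P 𝓕 T w := fun p hp ε hε =>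
  ⟨p, hp, by simp [hε.le], by simp [hε.le]⟩

lemma elementary_single {a b : ℝ} {c : Lp ℝ 2 P} (ha : 0 ≤ a) (hab : a ≤ b) (hb : b ≤ T)
    (hc : c ∈ lpMeas ℝ ℝ (𝓕 a) 2 P) :
    ((Ico a b).indicator (fun _ => c), increment P w a b c) ∈ elementary P 𝓕 T w :=
  Submodule.subset_span ⟨a, b, c, ha, hab, hb, hc, rfl⟩

/-- Two regimes are allowed: the integrand is small except on a short interval, where it is only
bounded. This covers integrals with different end points and partition cells cut by an end point. -/
lemma IsL2Integrator.elementary_norm_sq_le (hw : IsL2Integrator P 𝓕 T C w) (hT : 0 ≤ T)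
    {q : (ℝ → Lp ℝ 2 P) × Lp ℝ 2 P} (hq : q ∈ elementary P 𝓕 T w) {ε M a b : ℝ}
    (hab : a ≤ b)
    (h : ∀ s ∈ Ico 0 T, ‖q.1 s‖ ≤ ε ∨ (s ∈ Ico a b ∧ ‖q.1 s‖ ≤ M)) :
    ‖q.2‖ ^ 2 ≤ C * (T * ε ^ 2 + (b - a) * M ^ 2) := by
  have hint : ∫⁻ s in Ico 0 T, ‖q.1 s‖ₑ ^ 2 ≤ ENNReal.ofReal (T * ε ^ 2 + (b - a) * M ^ 2) := by
    calc ∫⁻ s in Ico 0 T, ‖q.1 s‖ₑ ^ 2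
        ≤ ∫⁻ s in Ico 0 T, (ENNReal.ofReal (ε ^ 2)
            + (Ico a b).indicator (fun _ => ENNReal.ofReal (M ^ 2)) s) := by
          refine setLIntegral_mono' measurableSet_Ico fun s hs => ?_
          have key : ∀ r : ℝ, ‖q.1 s‖ ≤ r → ‖q.1 s‖ₑ ^ 2 ≤ ENNReal.ofReal (r ^ 2) := fun r hr => by
            rw [← ofReal_norm, ← ENNReal.ofReal_pow (norm_nonneg _)]
            exact ENNReal.ofReal_le_ofReal (by gcongr)
          rcases h s hs with h | ⟨h1, h2⟩
          · exact (key _ h).trans le_self_add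
          · rw [indicator_of_mem h1]
            exact (key _ h2).trans le_add_self
      _ ≤ ENNReal.ofReal (ε ^ 2) * ENNReal.ofReal T + ENNReal.ofReal (M ^ 2) *
            ENNReal.ofReal (b - a) := by
          rw [lintegral_add_left measurable_const, setLIntegral_const, Real.volume_Ico, sub_zero]
          gcongr
          refine (setLIntegral_le_lintegral _ _).trans ?_
          rw [lintegral_indicator measurableSet_Ico, setLIntegral_const, Real.volume_Ico]
      _ = _ := by
          rw [← ENNReal.ofReal_mul (by positivity), ← ENNReal.ofReal_mul (by positivity),
            ← ENNReal.ofReal_add (by positivity)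
              (mul_nonneg (by positivity) (sub_nonneg.2 hab))]
          congr 1; ring
  have h2 := (hw.bound q hq).trans (mul_le_mul_right hint _)
  rw [← ofReal_norm, ← ENNReal.ofReal_pow (norm_nonneg _), ← ENNReal.ofReal_coe_nnreal,
    ← ENNReal.ofReal_mul C.coe_nonneg] at h2
  refine (ENNReal.ofReal_le_ofReal_iff ?_).1 h2
  have := sub_nonneg.2 hab
  positivity

/-- An elementary approximant within `η` satisfies the same alternative with `ε + η` and `M + η`;
then `η → 0`. -/
lemma IsL2Integrator.norm_sq_le (hw : IsL2Integrator P 𝓕 T C w) (hT : 0 ≤ T)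
    {p : (ℝ → Lp ℝ 2 P) × Lp ℝ 2 P} (hp : p ∈ itoGraph P 𝓕 T w) {ε M a b : ℝ}
    (hab : a ≤ b) (h : ∀ s ∈ Ico 0 T, ‖p.1 s‖ ≤ ε ∨ (s ∈ Ico a b ∧ ‖p.1 s‖ ≤ M)) :
    ‖p.2‖ ^ 2 ≤ C * (T * ε ^ 2 + (b - a) * M ^ 2) := by
  have hb : ∀ η > 0, ‖p.2‖ ≤
      Real.sqrt (C * (T * (ε + η) ^ 2 + (b - a) * (M + η) ^ 2)) + η := by
    intro η hη
    obtain ⟨q, hq, h1, h2⟩ := hp η hη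
    have h3 : ∀ s ∈ Ico 0 T, ∀ r, ‖p.1 s‖ ≤ r → ‖q.1 s‖ ≤ r + η := fun s hs r hr => by
      have := norm_sub_norm_le (q.1 s) (p.1 s)
      rw [norm_sub_rev] at this
      linarith [h1 s hs]
    have := hw.elementary_norm_sq_le hT hq hab (ε := ε + η) (M := M + η) fun s hs =>
      (h s hs).imp (h3 s hs _) (And.imp_right (h3 s hs _))
    have h4 := Real.le_sqrt_of_sq_le this
    have h5 := norm_sub_norm_le p.2 q.2
    linarith
  have hlim : Tendsto (fun η => Real.sqrt (C * (T * (ε + η) ^ 2 + (b - a) * (M + η) ^ 2)) + η)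
      (𝓝[>] 0) (𝓝 (Real.sqrt (C * (T * (ε + 0) ^ 2 + (b - a) * (M + 0) ^ 2)) + 0)) :=
    (Continuous.tendsto (by fun_prop) 0).mono_left nhdsWithin_le_nhds
  have h6 : ‖p.2‖ ≤ Real.sqrt (C * (T * (ε + 0) ^ 2 + (b - a) * (M + 0) ^ 2)) + 0 :=
    ge_of_tendsto hlim (eventually_mem_nhdsWithin.mono fun η hη => hb η hη)
  rw [add_zero, add_zero, add_zero] at h6
  have := sub_nonneg.2 hab
  exact (Real.le_sqrt (norm_nonneg _) (by positivity)).1 h6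

lemma IsL2Integrator.norm_le (hw : IsL2Integrator P 𝓕 T C w) (hT : 0 ≤ T)
    {p : (ℝ → Lp ℝ 2 P) × Lp ℝ 2 P} (hp : p ∈ itoGraph P 𝓕 T w) {ε : ℝ} (hε : 0 ≤ ε)
    (h : ∀ s ∈ Ico 0 T, ‖p.1 s‖ ≤ ε) : ‖p.2‖ ≤ Real.sqrt (C * T) * ε := by
  have := hw.norm_sq_le hT hp (le_refl (0 : ℝ)) (M := 0) (fun s hs => Or.inl (h s hs))
  refine abs_le_of_sq_le_sq' ?_ (by positivity) |>.2
  rw [mul_pow, Real.sq_sqrt (by positivity)]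
  linarith

lemma IsL2Integrator.eq_of_mem (hw : IsL2Integrator P 𝓕 T C w) (hT : 0 ≤ T)
    {F G : ℝ → Lp ℝ 2 P} {x y : Lp ℝ 2 P} (hF : (F, x) ∈ itoGraph P 𝓕 T w)
    (hG : (G, y) ∈ itoGraph P 𝓕 T w) (h : ∀ s ∈ Ico 0 T, F s = G s) : x = y := by
  have := hw.norm_le hT (sub_mem hF hG) le_rfl fun s hs => by simp [h s hs]
  simpa [sub_eq_zero] using this

/-- The integrals of uniformly close elementary integrands are close by `norm_le`, hence Cauchy, and
`L²` is complete. -/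
lemma IsL2Integrator.exists_mem_itoGraph (hw : IsL2Integrator P 𝓕 T C w) (hT : 0 ≤ T)
    {F : ℝ → Lp ℝ 2 P}
    (h : ∀ ε > 0, ∃ q ∈ elementary P 𝓕 T w, ∀ s ∈ Ico 0 T, ‖F s - q.1 s‖ ≤ ε) :
    ∃ x, (F, x) ∈ itoGraph P 𝓕 T w := by
  choose! q hq hF using h
  have hdiff : ∀ ε > 0, ∀ δ > 0, ‖(q ε).2 - (q δ).2‖ ≤ Real.sqrt (C * T) * (ε + δ) := by
    intro ε hε δ hδ
    refine hw.norm_le hT (elementary_le_itoGraph (sub_mem (hq ε hε) (hq δ hδ))) (by positivity)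
      fun s hs => ?_
    have : (q ε - q δ).1 s = (F s - (q δ).1 s) - (F s - (q ε).1 s) := by
      simp only [Prod.fst_sub, Pi.sub_apply]; abel
    rw [this]
    exact (norm_sub_le _ _).trans (by linarith [hF ε hε s hs, hF δ hδ s hs])
  let e : ℕ → ℝ := fun n => 1 / ((n : ℝ) + 1)
  have he : ∀ n, 0 < e n := fun n => Nat.one_div_pos_of_nat
  have he0 : Tendsto e atTop (𝓝 0) := tendsto_one_div_add_atTop_nhds_zero_nat
  have hc : CauchySeq fun n => (q (e n)).2 := by
    refine cauchySeq_of_le_tendsto_0 (fun n => Real.sqrt (C * T) * (e n + e n)) ?_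
      (by simpa using (he0.add he0).const_mul (Real.sqrt (C * T)))
    intro n m N hn hm
    rw [dist_eq_norm]
    refine (hdiff _ (he n) _ (he m)).trans ?_
    gcongr
    · exact Nat.one_div_le_one_div hn
    · exact Nat.one_div_le_one_div hm
  obtain ⟨x, hx⟩ := cauchySeq_tendsto_of_complete hc
  refine ⟨x, fun ε hε => ?_⟩
  have h1 := (he0.eventually (Iio_mem_nhds hε)).and (hx.eventually (Metric.ball_mem_nhds x hε))
  obtain ⟨n, hn1, hn2⟩ := h1.exists
  refine ⟨q (e n), hq _ (he n), fun s hs => (hF _ (he n) s hs).trans (le_of_lt hn1), ?_⟩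
  rw [← dist_eq_norm, dist_comm]
  exact (Metric.mem_ball.1 hn2).le

lemma coeFn_increment (hw : IsL2Integrator P 𝓕 T C w) {a b : ℝ} {c : Lp ℝ 2 P}
    (ha : 0 ≤ a) (hab : a ≤ b) (hb : b ≤ T) (hc : c ∈ lpMeas ℝ ℝ (𝓕 a) 2 P) :
    increment P w a b c =ᵐ[P] fun ω => c ω * (w b ω - w a ω) := by
  rw [increment, dif_pos (hw.memLp a b ha hab hb c hc)]
  exact MemLp.coeFn_toLp _

lemma lpMeas_mono {a b : ℝ} (hab : a ≤ b) : lpMeas ℝ ℝ (𝓕 a) 2 P ≤ lpMeas ℝ ℝ (𝓕 b) 2 P :=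
  fun f hf => by
    rw [mem_lpMeas_iff_aestronglyMeasurable] at hf ⊢
    exact hf.mono (𝓕.mono hab)

lemma increment_mem (hw : IsL2Integrator P 𝓕 T C w) {a b : ℝ} {c : Lp ℝ 2 P}
    (ha : 0 ≤ a) (hab : a ≤ b) (hb : b ≤ T) (hc : c ∈ lpMeas ℝ ℝ (𝓕 a) 2 P) :
    increment P w a b c ∈ lpMeas ℝ ℝ (𝓕 b) 2 P := by
  rw [mem_lpMeas_iff_aestronglyMeasurable]
  refine AEStronglyMeasurable.congr ?_ (coeFn_increment hw ha hab hb hc).symm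
  have h1 := mem_lpMeas_iff_aestronglyMeasurable.1 (lpMeas_mono hab hc)
  exact h1.mul (hw.measurable a b ha hab hb).stronglyMeasurable.aestronglyMeasurable

lemma isClosed_lpMeas (a : ℝ) : IsClosed (lpMeas ℝ ℝ (𝓕 a) 2 P : Set (Lp ℝ 2 P)) := by
  have := isClosed_aestronglyMeasurable (F := ℝ) (p := 2) (μ := P) (𝓕.le a)
  convert this using 1
  exact Set.ext fun f => mem_lpMeas_iff_aestronglyMeasurable

end Graph

/-! ### Wiener processes and time are integrators -/

section Wiener

variable {P : Measure Ω} {𝓕 : Filtration ℝ mΩ} {T : ℝ}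
  {f : ℝ → Ω → ℝ}

lemma IsWiener.measurable_sub (hf : IsWiener P 𝓕 T f) {a b : ℝ} (ha : 0 ≤ a) (hab : a ≤ b)
    (hb : b ≤ T) : Measurable[𝓕 b] (fun ω => f b ω - f a ω) :=
  Measurable.sub (m := 𝓕 b) (hf.adapted b ⟨ha.trans hab, hb⟩)
    ((hf.adapted a ⟨ha, hab.trans hb⟩).mono (𝓕.mono hab) le_rfl)

lemma IsWiener.memLp_sub (hf : IsWiener P 𝓕 T f) {a b : ℝ} (ha : 0 ≤ a) (hab : a ≤ b)
    (hb : b ≤ T) : MemLp (fun ω => f b ω - f a ω) 2 P := by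
  rcases hab.eq_or_lt with rfl | hlt
  · simp
  · have hlaw := hf.law a b ha hlt hb
    have h := memLp_id_gaussianReal (μ := 0) (v := (b - a).toNNReal) 2
    rw [← hlaw.map_eq] at h
    exact h.comp_of_map hlaw.aemeasurable

lemma IsWiener.integral_sub (hf : IsWiener P 𝓕 T f) {a b : ℝ} (ha : 0 ≤ a) (hab : a ≤ b)
    (hb : b ≤ T) : ∫ ω, (f b ω - f a ω) ∂P = 0 := by
  rcases hab.eq_or_lt with rfl | hlt
  · simp
  · rw [(hf.law a b ha hlt hb).integral_eq, integral_id_gaussianReal]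

lemma IsWiener.indepFun_sub (hf : IsWiener P 𝓕 T f) {a b : ℝ} (ha : 0 ≤ a) (hab : a < b)
    (hb : b ≤ T) {g : Ω → ℝ} (hg : Measurable[𝓕 a] g) :
    IndepFun g (fun ω => f b ω - f a ω) P := by
  rw [IndepFun_iff_Indep]
  exact (indep_of_indep_of_le_right (hf.indep a b ha hab hb) hg.comap_le).symm

lemma IsWiener.integral_sub_sq (hf : IsWiener P 𝓕 T f) {a b : ℝ} (ha : 0 ≤ a) (hab : a ≤ b)
    (hb : b ≤ T) : ∫ ω, (f b ω - f a ω) ^ 2 ∂P = b - a := by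
  rcases hab.eq_or_lt with rfl | hlt
  · simp
  · have hlaw := hf.law a b ha hlt hb
    have h := hlaw.variance_eq
    rw [variance_id_gaussianReal, variance_eq_integral hlaw.aemeasurable,
      hf.integral_sub ha hab hb] at h
    simpa [sub_nonneg.2 hab] using h

variable [IsProbabilityMeasure P]

lemma IsWiener.integrable_mul_sub (hf : IsWiener P 𝓕 T f) {a b : ℝ} (ha : 0 ≤ a) (hab : a ≤ b)
    (hb : b ≤ T) {g : Ω → ℝ} (hg : AEStronglyMeasurable[𝓕 a] g P) (hgi : Integrable g P) :
    Integrable (fun ω => g ω * (f b ω - f a ω)) P ∧ ∫ ω, g ω * (f b ω - f a ω) ∂P = 0 := by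
  rcases hab.eq_or_lt with rfl | hlt
  · simp
  · obtain ⟨g', hg', he⟩ := hg
    have hind := hf.indepFun_sub ha hlt hb hg'.measurable
    have hD := (hf.memLp_sub ha hab hb).integrable one_le_two
    have hc : (fun ω => g ω * (f b ω - f a ω)) =ᵐ[P] fun ω => g' ω * (f b ω - f a ω) := by
      filter_upwards [he] with ω hω
      rw [hω]
    refine ⟨(integrable_congr hc).2 (hind.integrable_mul (hgi.congr he) hD), ?_⟩
    rw [integral_congr_ae hc, hind.integral_fun_mul_eq_mul_integral
      (hgi.congr he).aestronglyMeasurable hD.aestronglyMeasurable, hf.integral_sub ha hab hb,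
      mul_zero]

lemma IsWiener.integrable_mul_sub_sq (hf : IsWiener P 𝓕 T f) {a b : ℝ} (ha : 0 ≤ a)
    (hab : a ≤ b) (hb : b ≤ T) {g : Ω → ℝ} (hg : AEStronglyMeasurable[𝓕 a] g P)
    (hgi : Integrable g P) :
    Integrable (fun ω => g ω * (f b ω - f a ω) ^ 2) P ∧
      ∫ ω, g ω * (f b ω - f a ω) ^ 2 ∂P = (∫ ω, g ω ∂P) * (b - a) := by
  rcases hab.eq_or_lt with rfl | hlt
  · simp
  · obtain ⟨g', hg', he⟩ := hg
    have hind : IndepFun g' (fun ω => (f b ω - f a ω) ^ 2) P :=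
      (hf.indepFun_sub ha hlt hb hg'.measurable).comp measurable_id
        (measurable_id.pow_const 2)
    have hD := (hf.memLp_sub ha hab hb).integrable_sq
    have hc : (fun ω => g ω * (f b ω - f a ω) ^ 2) =ᵐ[P]
        fun ω => g' ω * (f b ω - f a ω) ^ 2 := by
      filter_upwards [he] with ω hω
      rw [hω]
    refine ⟨(integrable_congr hc).2 (hind.integrable_mul (hgi.congr he) hD), ?_⟩
    rw [integral_congr_ae hc, hind.integral_fun_mul_eq_mul_integral
      (hgi.congr he).aestronglyMeasurable hD.aestronglyMeasurable, hf.integral_sub_sq ha hab hb,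
      integral_congr_ae he]

lemma IsWiener.memLp_mul_sub (hf : IsWiener P 𝓕 T f) {a b : ℝ} (ha : 0 ≤ a) (hab : a ≤ b)
    (hb : b ≤ T) {c : Ω → ℝ} (hc : AEStronglyMeasurable[𝓕 a] c P) (hc2 : MemLp c 2 P) :
    MemLp (fun ω => c ω * (f b ω - f a ω)) 2 P := by
  have hm := hc2.aestronglyMeasurable.mul (hf.memLp_sub ha hab hb).aestronglyMeasurable
  refine (memLp_two_iff_integrable_sq hm).2 ?_
  refine (hf.integrable_mul_sub_sq ha hab hb (hc.pow 2) hc2.integrable_sq).1.congr ?_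
  exact ae_of_all _ fun ω => by simp only [Pi.pow_apply, Pi.mul_apply]; ring

/-- Since `a ≤ a'`, the last factor is the length of the overlap of the two intervals. Without
overlap the later increment is independent of everything else and has mean zero. With overlap the
earlier increment is cut at `a'`, and only the part after `a'` contributes. -/
lemma IsWiener.integral_mul_mul (hf : IsWiener P 𝓕 T f) {a b a' b' : ℝ} (ha : 0 ≤ a)
    (hab : a ≤ b) (hb : b ≤ T) (hab' : a' ≤ b') (hb' : b' ≤ T) (haa' : a ≤ a')
    {c c' : Ω → ℝ} (hc : AEStronglyMeasurable[𝓕 a] c P) (hc2 : MemLp c 2 P)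
    (hc' : AEStronglyMeasurable[𝓕 a'] c' P) (hc2' : MemLp c' 2 P) :
    ∫ ω, (c ω * (f b ω - f a ω)) * (c' ω * (f b' ω - f a' ω)) ∂P =
      (∫ ω, c ω * c' ω ∂P) * max (min b b' - a') 0 := by
  have ha' : 0 ≤ a' := ha.trans haa'
  rcases le_or_gt b a' with hba | hba
  · have hg : AEStronglyMeasurable[𝓕 a'] (fun ω => c ω * (f b ω - f a ω) * c' ω) P :=
      ((hc.mono (𝓕.mono haa')).mul ((hf.measurable_sub ha hab hb).mono
        (𝓕.mono hba) le_rfl).stronglyMeasurable.aestronglyMeasurable).mul hc'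
    have h := (hf.integrable_mul_sub ha' hab' hb' hg
      ((hf.memLp_mul_sub ha hab hb hc hc2).integrable_mul hc2')).2
    rw [max_eq_right (by simp [hba]), mul_zero, ← h]
    congr 1; ext ω; ring
  · have hg1 : AEStronglyMeasurable[𝓕 a'] (fun ω => c ω * (f a' ω - f a ω) * c' ω) P :=
      ((hc.mono (𝓕.mono haa')).mul ((hf.measurable_sub ha haa'
        (hab'.trans hb')).stronglyMeasurable.aestronglyMeasurable)).mul hc'
    have h1 := hf.integrable_mul_sub ha' hab' hb' hg1
      ((hf.memLp_mul_sub ha haa' (hab'.trans hb') hc hc2).integrable_mul hc2')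
    have hg2 : AEStronglyMeasurable[𝓕 a'] (fun ω => c ω * c' ω) P :=
      (hc.mono (𝓕.mono haa')).mul hc'
    have hi2 : Integrable (fun ω => c ω * c' ω) P := hc2.integrable_mul hc2'
    have h2 := hf.integrable_mul_sub_sq ha' hba.le hb hg2 hi2
    have h3 := hf.integrable_mul_sub_sq ha' hab' hb' hg2 hi2
    have hq : a' ≤ min b b' := le_min hba.le hab'
    have h4 := hf.integrable_mul_sub_sq (ha'.trans hq) min_le_max (max_le hb hb')
      (hg2.mono (𝓕.mono hq)) hi2
    have hsq : ∀ ω, (f (max b b') ω - f (min b b') ω) ^ 2 = (f b ω - f b' ω) ^ 2 := fun ω => by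
      rcases le_total b b' with h | h
      · rw [max_eq_right h, min_eq_left h]; ring
      · rw [max_eq_left h, min_eq_right h]
    simp only [hsq] at h4
    -- Polarization: the product of the increments from `a'` to `b` and to `b'` becomes a
    -- combination of squares of single increments, each independent of `c c'`.
    have hsplit : ∀ ω, (c ω * (f b ω - f a ω)) * (c' ω * (f b' ω - f a' ω)) =
        c ω * (f a' ω - f a ω) * c' ω * (f b' ω - f a' ω) +
        (1 / 2) * (c ω * c' ω * (f b ω - f a' ω) ^ 2 + c ω * c' ω * (f b' ω - f a' ω) ^ 2
          - c ω * c' ω * (f b ω - f b' ω) ^ 2) := fun ω => by ring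
    simp only [hsplit]
    have h23 : Integrable (fun ω => c ω * c' ω * (f b ω - f a' ω) ^ 2 +
      c ω * c' ω * (f b' ω - f a' ω) ^ 2) P := h2.1.add h3.1
    have h234 : Integrable (fun ω => (1 / 2) * (c ω * c' ω * (f b ω - f a' ω) ^ 2 +
      c ω * c' ω * (f b' ω - f a' ω) ^ 2 - c ω * c' ω * (f b ω - f b' ω) ^ 2)) P :=
      (h23.sub h4.1).const_mul _
    rw [integral_add h1.1 h234, h1.2, integral_const_mul,
      MeasureTheory.integral_sub h23 h4.1, integral_add h2.1 h3.1, h2.2, h3.2, h4.2,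
      max_eq_left (sub_nonneg.2 hq)]
    rcases le_total b b' with h | h
    · rw [max_eq_right h, min_eq_left h]; ring
    · rw [max_eq_left h, min_eq_right h]; ring

/-- The Ito isometry. It is proved in bilinear form by induction over both spans, which reduces it
to two one-step processes and avoids refining partitions. -/
lemma IsWiener.isL2Integrator (hf : IsWiener P 𝓕 T f) {C : ℝ≥0} (hC : 1 ≤ C) :
    IsL2Integrator P 𝓕 T C f := by
  have hmem : ∀ a b, 0 ≤ a → a ≤ b → b ≤ T → ∀ c ∈ lpMeas ℝ ℝ (𝓕 a) 2 P,
      MemLp (fun ω => c ω * (f b ω - f a ω)) 2 P := fun a b ha hab hb c hc =>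
    hf.memLp_mul_sub ha hab hb (mem_lpMeas_iff_aestronglyMeasurable.1 hc) (Lp.memLp c)
  have hinc : ∀ a b, 0 ≤ a → a ≤ b → b ≤ T → ∀ c ∈ lpMeas ℝ ℝ (𝓕 a) 2 P,
      increment P f a b c =ᵐ[P] fun ω => c ω * (f b ω - f a ω) := fun a b ha hab hb c hc => by
    rw [increment, dif_pos (hmem a b ha hab hb c hc)]
    exact MemLp.coeFn_toLp _
  have hgram : ∀ a b, 0 ≤ a → a ≤ b → b ≤ T → ∀ c ∈ lpMeas ℝ ℝ (𝓕 a) 2 P,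
      ∀ a' b', 0 ≤ a' → a' ≤ b' → b' ≤ T → ∀ c' ∈ lpMeas ℝ ℝ (𝓕 a') 2 P, a ≤ a' →
      inner ℝ (increment P f a b c) (increment P f a' b' c') =
        inner ℝ c c' * max (min b b' - a') 0 := by
    intro a b ha hab hb c hc a' b' ha' hab' hb' c' hc' haa'
    rw [L2.inner_def, L2.inner_def]
    have h := hf.integral_mul_mul ha hab hb hab' hb' haa'
      (mem_lpMeas_iff_aestronglyMeasurable.1 hc) (Lp.memLp c)
      (mem_lpMeas_iff_aestronglyMeasurable.1 hc') (Lp.memLp c')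
    simp only [RCLike.inner_apply, conj_trivial]
    rw [integral_congr_ae (g := fun ω => (c ω * (f b ω - f a ω)) * (c' ω * (f b' ω - f a' ω))),
      h]
    · congr 2; ext ω; ring
    · filter_upwards [hinc a b ha hab hb c hc, hinc a' b' ha' hab' hb' c' hc'] with ω h1 h2
      rw [h1, h2, mul_comm]
  have key : ∀ p ∈ elementary P 𝓕 T f, ∀ q ∈ elementary P 𝓕 T f,
      IntegrableOn (fun s => inner ℝ (p.1 s) (q.1 s)) (Ico 0 T) ∧
      inner ℝ p.2 q.2 = ∫ s in Ico 0 T, inner ℝ (p.1 s) (q.1 s) := by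
    intro p hp q hq
    induction hp, hq using Submodule.span_induction₂ with
    | mem_mem x y hx hy =>
      obtain ⟨a, b, c, ha, hab, hb, hc, rfl⟩ := hx
      obtain ⟨a', b', c', ha', hab', hb', hc', rfl⟩ := hy
      have h1 : ∀ s, inner ℝ ((Ico a b).indicator (fun _ => c) s)
          ((Ico a' b').indicator (fun _ => c') s) =
          (Ico (max a a') (min b b')).indicator (fun _ => inner ℝ c c') s := fun s => by
        rw [← Ico_inter_Ico]
        by_cases hs : s ∈ Ico a b <;> by_cases hs' : s ∈ Ico a' b' <;> simp [hs, hs']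
      simp only [h1]
      have hsub : Ico (max a a') (min b b') ⊆ Ico 0 T := fun s hs =>
        ⟨(ha.trans (le_max_left _ _)).trans hs.1, hs.2.trans_le ((min_le_left _ _).trans hb)⟩
      refine ⟨(integrable_indicator_iff measurableSet_Ico).2
        (integrableOn_const (by simp)) |>.integrableOn, ?_⟩
      rw [setIntegral_indicator measurableSet_Ico, inter_eq_right.2 hsub, setIntegral_const,
        Real.volume_real_Ico, smul_eq_mul, mul_comm]
      rcases le_total a a' with h | h
      · rw [hgram a b ha hab hb c hc a' b' ha' hab' hb' c' hc' h, max_eq_right h]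
      · rw [real_inner_comm, hgram a' b' ha' hab' hb' c' hc' a b ha hab hb c hc h,
          max_eq_left h, min_comm, real_inner_comm]
    | zero_left y hy => simp
    | zero_right x hx => simp
    | add_left x y z _ _ _ h1 h2 =>
      simp only [Prod.fst_add, Prod.snd_add, Pi.add_apply, inner_add_left]
      exact ⟨h1.1.add h2.1, by rw [h1.2, h2.2, integral_add h1.1 h2.1]⟩
    | add_right x y z _ _ _ h1 h2 =>
      simp only [Prod.fst_add, Prod.snd_add, Pi.add_apply, inner_add_right]
      exact ⟨h1.1.add h2.1, by rw [h1.2, h2.2, integral_add h1.1 h2.1]⟩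
    | smul_left r x y _ _ h =>
      simp only [Prod.smul_fst, Prod.smul_snd, Pi.smul_apply, real_inner_smul_left]
      exact ⟨h.1.const_mul _, by rw [h.2, integral_const_mul]⟩
    | smul_right r x y _ _ h =>
      simp only [Prod.smul_fst, Prod.smul_snd, Pi.smul_apply, real_inner_smul_right]
      exact ⟨h.1.const_mul _, by rw [h.2, integral_const_mul]⟩
  refine ⟨fun a b => hf.measurable_sub, hmem, fun p hp => ?_⟩
  obtain ⟨h1, h2⟩ := key p hp p hp
  simp only [real_inner_self_eq_norm_sq] at h1 h2
  calc ‖p.2‖ₑ ^ 2 = ∫⁻ s in Ico 0 T, ‖p.1 s‖ₑ ^ 2 := by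
        rw [← ofReal_norm, ← ENNReal.ofReal_pow (norm_nonneg _), h2,
          ofReal_integral_eq_lintegral_ofReal h1 (ae_of_all _ fun s => by positivity)]
        congr 1; ext s
        rw [← ofReal_norm, ← ENNReal.ofReal_pow (norm_nonneg _)]
    _ ≤ C * ∫⁻ s in Ico 0 T, ‖p.1 s‖ₑ ^ 2 :=
        le_mul_of_one_le_left zero_le (by exact_mod_cast hC)

end Wiener

/-- The elementary integral against time is the Bochner integral over `[0, T)`, and Cauchy–Schwarz
against the constant `1` gives the constant `T`. -/
lemma isL2Integrator_time {P : Measure Ω} {𝓕 : Filtration ℝ mΩ} {T : ℝ} {C : ℝ≥0}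
    (hC : T ≤ C) : IsL2Integrator P 𝓕 T C (fun s _ => s) := by
  have hmem : ∀ a b, ∀ c : Lp ℝ 2 P, MemLp (fun ω => c ω * (b - a)) 2 P := fun a b c =>
    (Lp.memLp c).mul_const _
  have hinc : ∀ a b, ∀ c : Lp ℝ 2 P, increment P (fun s _ => s) a b c = (b - a) • c := by
    intro a b c
    rw [increment, dif_pos (hmem a b c)]
    refine Lp.ext ?_
    filter_upwards [MemLp.coeFn_toLp (hmem a b c), Lp.coeFn_smul (b - a) c] with ω h1 h2
    rw [h1, h2, Pi.smul_apply, smul_eq_mul, mul_comm]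
  have key : ∀ p ∈ elementary P 𝓕 T (fun s _ => s), IntegrableOn p.1 (Ico 0 T) ∧
      p.2 = ∫ s in Ico 0 T, p.1 s := by
    intro p hp
    induction hp using Submodule.span_induction with
    | mem x hx =>
      obtain ⟨a, b, c, ha, hab, hb, hc, rfl⟩ := hx
      refine ⟨(integrable_indicator_iff measurableSet_Ico).2
        (integrableOn_const (by simp)) |>.integrableOn, ?_⟩
      have hsub : Ico a b ⊆ Ico 0 T := Ico_subset_Ico ha hb
      simp only
      rw [setIntegral_indicator measurableSet_Ico, inter_eq_right.2 hsub, setIntegral_const,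
        Real.volume_real_Ico, max_eq_left (sub_nonneg.2 hab), hinc]
    | zero => exact ⟨integrableOn_zero, by simp⟩
    | add x y _ _ h1 h2 =>
      refine ⟨h1.1.add h2.1, ?_⟩
      simp only [Prod.fst_add, Prod.snd_add, Pi.add_apply]
      rw [integral_add h1.1 h2.1, h1.2, h2.2]
    | smul r x _ h =>
      refine ⟨h.1.smul r, ?_⟩
      simp only [Prod.smul_fst, Prod.smul_snd, Pi.smul_apply]
      rw [integral_smul, h.2]
  refine ⟨fun a b _ _ _ => measurable_const, fun a b _ _ _ c _ => hmem a b c, fun p hp => ?_⟩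
  obtain ⟨h1, h2⟩ := key p hp
  have hm := h1.aestronglyMeasurable.enorm
  have h3 : ‖p.2‖ₑ ≤ ∫⁻ s in Ico 0 T, ‖p.1 s‖ₑ := by
    rw [h2]; exact enorm_integral_le_lintegral_enorm _
  have h4 := ENNReal.lintegral_mul_le_Lp_mul_Lq (volume.restrict (Ico 0 T))
    Real.HolderConjugate.two_two hm (aemeasurable_const (b := (1 : ℝ≥0∞)))
  simp only [Pi.mul_apply, mul_one, ENNReal.one_rpow, lintegral_const, one_mul,
    Measure.restrict_apply MeasurableSet.univ, univ_inter, Real.volume_Ico, sub_zero] at h4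
  calc ‖p.2‖ₑ ^ 2 ≤ ((∫⁻ s in Ico 0 T, ‖p.1 s‖ₑ ^ (2 : ℝ)) ^ (1 / 2 : ℝ) *
        ENNReal.ofReal T ^ (1 / 2 : ℝ)) ^ 2 := by gcongr; exact h3.trans h4
    _ = (∫⁻ s in Ico 0 T, ‖p.1 s‖ₑ ^ (2 : ℝ)) * ENNReal.ofReal T := by
        rw [mul_pow, ← ENNReal.rpow_natCast, ← ENNReal.rpow_natCast, ← ENNReal.rpow_mul,
          ← ENNReal.rpow_mul]
        norm_num
    _ ≤ C * ∫⁻ s in Ico 0 T, ‖p.1 s‖ₑ ^ 2 := by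
        rw [mul_comm]
        simp only [ENNReal.rpow_ofNat]
        gcongr
        exact ENNReal.ofReal_le_of_le_toReal (by simpa using hC)

/-! ### Partitions -/

namespace Partition

variable {a b : ℝ}

lemma pt_le_pt (π : Partition a b) {i j : ℕ} (hij : i ≤ j) (hj : j ≤ π.N) : π.pt i ≤ π.pt j := by
  induction j, hij using Nat.le_induction with
  | base => exact le_rfl
  | succ k _ ih => exact (ih (by omega)).trans (π.pt_lt k (by omega)).le

lemma left_le_pt (π : Partition a b) {j : ℕ} (hj : j ≤ π.N) : a ≤ π.pt j := by
  have := π.pt_le_pt (Nat.zero_le j) hj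
  rwa [π.pt_zero] at this

lemma pt_le_right (π : Partition a b) {j : ℕ} (hj : j ≤ π.N) : π.pt j ≤ b := by
  have := π.pt_le_pt hj le_rfl
  rwa [π.pt_last] at this

lemma pt_mem_Icc (π : Partition a b) {j : ℕ} (hj : j ≤ π.N) : π.pt j ∈ Icc a b :=
  ⟨π.left_le_pt hj, π.pt_le_right hj⟩

lemma exists_mem_Ico (π : Partition a b) {s : ℝ} (hs : s ∈ Ico a b) :
    ∃ j < π.N, s ∈ Ico (π.pt j) (π.pt (j + 1)) := by
  by_contra! h
  have : ∀ j ≤ π.N, π.pt j ≤ s := by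
    intro j
    induction j with
    | zero => intro _; rw [π.pt_zero]; exact hs.1
    | succ k ih =>
      intro hk
      by_contra! h'
      exact h k (by omega) ⟨ih (by omega), h'⟩
  have h2 := this π.N le_rfl
  rw [π.pt_last] at h2
  exact absurd hs.2 (not_lt.2 h2)

lemma sum_indicator_of_mem {E : Type*} [AddCommMonoid E] (π : Partition a b) (c : ℕ → E) {j : ℕ}
    (hj : j < π.N) {s : ℝ} (hs : s ∈ Ico (π.pt j) (π.pt (j + 1))) :
    ∑ k ∈ Finset.range π.N, (Ico (π.pt k) (π.pt (k + 1))).indicator (fun _ => c k) s = c j := by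
  rw [Finset.sum_eq_single_of_mem j (Finset.mem_range.2 hj), indicator_of_mem hs]
  intro k hk hkj
  refine indicator_of_notMem (fun hs' => ?_) _
  rw [Finset.mem_range] at hk
  rcases lt_or_gt_of_ne hkj with h | h
  · exact absurd (hs'.2.trans_le (π.pt_le_pt (show k + 1 ≤ j by omega) hj.le)) (not_lt.2 hs.1)
  · exact absurd (hs.2.trans_le (π.pt_le_pt (show j + 1 ≤ k by omega) hk.le)) (not_lt.2 hs'.1)

lemma sum_indicator_of_notMem {E : Type*} [AddCommMonoid E] (π : Partition a b) (c : ℕ → E)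
    {s : ℝ} (hs : s ∉ Ico a b) :
    ∑ k ∈ Finset.range π.N, (Ico (π.pt k) (π.pt (k + 1))).indicator (fun _ => c k) s = 0 := by
  refine Finset.sum_eq_zero fun k hk => indicator_of_notMem (fun hs' => hs ?_) _
  rw [Finset.mem_range] at hk
  exact ⟨(π.left_le_pt hk.le).trans hs'.1, hs'.2.trans_le (π.pt_le_right hk)⟩

lemma sub_le_mesh (π : Partition a b) {j : ℕ} (hj : j < π.N) :
    π.pt (j + 1) - π.pt j ≤ π.mesh := by
  have h : Real.toNNReal (π.pt (j + 1) - π.pt j) ≤ π.mesh :=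
    Finset.le_sup (f := fun j => Real.toNNReal (π.pt (j + 1) - π.pt j)) (Finset.mem_range.2 hj)
  exact (Real.le_coe_toNNReal _).trans (by exact_mod_cast h)

/-- The partition of `[a, a]` with no steps. -/
def trivial (a : ℝ) : Partition a a := ⟨0, fun _ => a, rfl, rfl, by simp⟩

/-- The partition into `n + 1` steps of equal length. -/
def uniform (hab : a < b) (n : ℕ) : Partition a b where
  N := n + 1
  pt j := a + j * ((b - a) / (n + 1))
  pt_zero := by simp
  pt_last := by push_cast; field_simp; ring
  pt_lt j _ := by
    have : 0 < (b - a) / (n + 1) := div_pos (sub_pos.2 hab) (by positivity)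
    push_cast
    linarith

lemma mesh_uniform_le (hab : a < b) (n : ℕ) :
    ((uniform hab n).mesh : ℝ) ≤ (b - a) / (n + 1) := by
  have h0 : 0 ≤ (b - a) / ((n : ℝ) + 1) := div_nonneg (sub_nonneg.2 hab.le) (by positivity)
  have : (uniform hab n).mesh ≤ Real.toNNReal ((b - a) / (n + 1)) := by
    refine Finset.sup_le fun j _ => Real.toNNReal_le_toNNReal (le_of_eq ?_)
    simp only [uniform]
    push_cast
    ring
  have h2 : ((uniform hab n).mesh : ℝ) ≤ Real.toNNReal ((b - a) / (n + 1)) := by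
    exact_mod_cast this
  rwa [Real.coe_toNNReal _ h0] at h2

end Partition

/-- The filter of partitions of `[a, b]` whose mesh tends to zero. -/
def meshFilter (a b : ℝ) : Filter (Partition a b) := comap Partition.mesh (𝓝 0)

instance (a b : ℝ) : (meshFilter a b).IsCountablyGenerated := by
  unfold meshFilter; infer_instance

lemma eventually_mesh_lt {a b δ : ℝ} (hδ : 0 < δ) : ∀ᶠ π in meshFilter a b, (π.mesh : ℝ) < δ := by
  have h : ∀ᶠ x : ℝ≥0 in 𝓝 0, (x : ℝ) < δ :=
    (NNReal.continuous_coe.tendsto 0).eventually (Iio_mem_nhds (by simpa using hδ))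
  exact (tendsto_comap (f := Partition.mesh)).eventually h

lemma meshFilter_neBot {a b : ℝ} (hab : a ≤ b) : (meshFilter a b).NeBot := by
  rcases hab.eq_or_lt with rfl | hlt
  · refine comap_neBot fun t ht => ⟨Partition.trivial a, ?_⟩
    have : (Partition.trivial a).mesh = 0 := by simp [Partition.mesh, Partition.trivial]
    rw [this]
    exact mem_of_mem_nhds ht
  · have h0 : Tendsto (fun n => (Partition.uniform hlt n).mesh) atTop (𝓝 0) := by
      rw [← NNReal.tendsto_coe]
      refine squeeze_zero (fun _ => NNReal.coe_nonneg _)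
        (fun n => Partition.mesh_uniform_le hlt n) ?_
      have := (tendsto_one_div_add_atTop_nhds_zero_nat (𝕜 := ℝ)).const_mul (b - a)
      simpa [div_eq_mul_inv] using this
    exact (tendsto_comap_iff.2 h0 : Tendsto _ atTop (meshFilter a b)).neBot

/-- `meshFilter` is countably generated, so convergence along it can be tested on sequences. -/
lemma isMeanSquareLimit_iff {P : Measure Ω} {a b : ℝ} {S : Partition a b → Ω → ℝ} {X : Ω → ℝ} :
    IsMeanSquareLimit P S X ↔ MemLp X 2 P ∧
      Tendsto (fun π => eLpNorm (fun ω => S π ω - X ω) 2 P) (meshFilter a b) (𝓝 0) := by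
  refine and_congr_right fun _ => ⟨fun h => ?_, fun h π hπ => h.comp (tendsto_comap_iff.2 hπ)⟩
  exact tendsto_of_seq_tendsto fun π hπ =>
    h π ((tendsto_comap (f := Partition.mesh)).comp hπ)

/-! ### The Ito integral of a continuous adapted curve -/

/-- A mean-square continuous curve on `[a, b]`, adapted to the filtration. -/
structure IsAdaptedCurve (P : Measure Ω) (𝓕 : Filtration ℝ mΩ) (a b : ℝ) (A : ℝ → Lp ℝ 2 P) :
    Prop where
  cont : ContinuousOn A (Icc a b)
  adapted : ∀ s ∈ Icc a b, A s ∈ lpMeas ℝ ℝ (𝓕 s) 2 P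

/-- The step curve with value `c j` on `[τ_j, τ_{j+1})`. -/
def stepCurve {E : Type*} [AddCommMonoid E] {a b : ℝ} (π : Partition a b) (c : ℕ → E) : ℝ → E :=
  fun s => ∑ j ∈ Finset.range π.N, (Ico (π.pt j) (π.pt (j + 1))).indicator (fun _ => c j) s

/-- The elementary integral of a step curve. -/
def stepSum (P : Measure Ω) (w : ℝ → Ω → ℝ) {a b : ℝ} (π : Partition a b) (c : ℕ → Lp ℝ 2 P) :
    Lp ℝ 2 P :=
  ∑ j ∈ Finset.range π.N, increment P w (π.pt j) (π.pt (j + 1)) (c j)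

/-- The integral over `[a, b]`, characterized by membership in `itoGraph`. -/
def ito (P : Measure Ω) (𝓕 : Filtration ℝ mΩ) (T : ℝ) (w : ℝ → Ω → ℝ) (a b : ℝ)
    (A : ℝ → Lp ℝ 2 P) : Lp ℝ 2 P :=
  open Classical in
  if h : ∃ x, ((Ico a b).indicator A, x) ∈ itoGraph P 𝓕 T w then h.choose else 0

section Ito

variable {P : Measure Ω} {𝓕 : Filtration ℝ mΩ} {T : ℝ} {C : ℝ≥0} {w : ℝ → Ω → ℝ} {a b : ℝ}
  {A : ℝ → Lp ℝ 2 P}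

lemma step_mem_elementary (ha : 0 ≤ a) (hb : b ≤ T) (π : Partition a b) {c : ℕ → Lp ℝ 2 P}
    (hc : ∀ j < π.N, c j ∈ lpMeas ℝ ℝ (𝓕 (π.pt j)) 2 P) :
    (stepCurve π c, stepSum P w π c) ∈ elementary P 𝓕 T w := by
  have : (stepCurve π c, stepSum P w π c) = ∑ j ∈ Finset.range π.N,
      ((Ico (π.pt j) (π.pt (j + 1))).indicator (fun _ => c j),
        increment P w (π.pt j) (π.pt (j + 1)) (c j)) := by
    refine Prod.ext ?_ ?_
    · rw [Prod.fst_sum]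
      ext1 s
      rw [Finset.sum_apply]
      rfl
    · rw [Prod.snd_sum]
      rfl
  rw [this]
  refine Submodule.sum_mem _ fun j hj => ?_
  rw [Finset.mem_range] at hj
  exact elementary_single (ha.trans (π.left_le_pt hj.le)) (π.pt_lt j hj).le
    ((π.pt_le_right hj).trans hb) (hc j hj)

lemma IsAdaptedCurve.mono (hA : IsAdaptedCurve P 𝓕 a b A) {a' b' : ℝ} (ha : a ≤ a')
    (hb : b' ≤ b) : IsAdaptedCurve P 𝓕 a' b' A :=
  ⟨hA.cont.mono (Icc_subset_Icc ha hb), fun s hs => hA.adapted s (Icc_subset_Icc ha hb hs)⟩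

lemma IsAdaptedCurve.step_mem (hA : IsAdaptedCurve P 𝓕 a b A) (ha : 0 ≤ a) (hb : b ≤ T)
    (π : Partition a b) :
    (stepCurve π fun j => A (π.pt j), stepSum P w π fun j => A (π.pt j)) ∈
      elementary P 𝓕 T w :=
  step_mem_elementary ha hb π fun _ hj => hA.adapted _ (π.pt_mem_Icc hj.le)

/-- Uniform continuity on the compact interval; this is why closure under uniform convergence is
enough throughout. -/
lemma eventually_norm_sub_stepCurve_le {E : Type*} [NormedAddCommGroup E] {A : ℝ → E}
    (hA : ContinuousOn A (Icc a b)) {ε : ℝ} (hε : 0 < ε) :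
    ∀ᶠ π in meshFilter a b, ∀ s,
      ‖(Ico a b).indicator A s - stepCurve π (fun j => A (π.pt j)) s‖ ≤ ε := by
  have hu := isCompact_Icc.uniformContinuousOn_of_continuous hA
  obtain ⟨δ, hδ, h⟩ := Metric.uniformContinuousOn_iff.1 hu ε hε
  filter_upwards [eventually_mesh_lt hδ] with π hπ s
  by_cases hs : s ∈ Ico a b
  · obtain ⟨j, hj, hsj⟩ := π.exists_mem_Ico hs
    rw [indicator_of_mem hs, stepCurve, π.sum_indicator_of_mem _ hj hsj, ← dist_eq_norm]
    refine (h s (Ico_subset_Icc_self hs) _ (π.pt_mem_Icc hj.le) ?_).le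
    rw [Real.dist_eq, abs_of_nonneg (sub_nonneg.2 hsj.1)]
    linarith [π.sub_le_mesh hj, hsj.2]
  · rw [indicator_of_notMem hs, stepCurve, π.sum_indicator_of_notMem _ hs, sub_zero, norm_zero]
    exact hε.le

lemma IsAdaptedCurve.ito_mem (hA : IsAdaptedCurve P 𝓕 a b A) (hw : IsL2Integrator P 𝓕 T C w)
    (ha : 0 ≤ a) (hab : a ≤ b) (hb : b ≤ T) :
    ((Ico a b).indicator A, ito P 𝓕 T w a b A) ∈ itoGraph P 𝓕 T w := by
  have h : ∃ x, ((Ico a b).indicator A, x) ∈ itoGraph P 𝓕 T w := by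
    refine hw.exists_mem_itoGraph (ha.trans (hab.trans hb)) fun ε hε => ?_
    have := meshFilter_neBot hab
    obtain ⟨π, hπ⟩ := (eventually_norm_sub_stepCurve_le hA.cont hε).exists
    exact ⟨_, hA.step_mem ha hb π, fun s _ => hπ s⟩
  rw [ito, dif_pos h]
  exact h.choose_spec

lemma IsAdaptedCurve.tendsto_stepSum (hA : IsAdaptedCurve P 𝓕 a b A)
    (hw : IsL2Integrator P 𝓕 T C w) (ha : 0 ≤ a) (hab : a ≤ b) (hb : b ≤ T) :
    Tendsto (fun π : Partition a b => stepSum P w π fun j => A (π.pt j)) (meshFilter a b)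
      (𝓝 (ito P 𝓕 T w a b A)) := by
  rw [Metric.tendsto_nhds]
  intro ε hε
  have hη : 0 < ε / (Real.sqrt (C * T) + 1) := by positivity
  filter_upwards [eventually_norm_sub_stepCurve_le hA.cont hη] with π hπ
  have h := hw.norm_le (ha.trans (hab.trans hb)) (sub_mem (hA.ito_mem hw ha hab hb)
    (elementary_le_itoGraph (hA.step_mem ha hb π))) hη.le fun s _ => hπ s
  rw [dist_comm, dist_eq_norm]
  refine h.trans_lt ?_
  rw [mul_div_assoc', div_lt_iff₀ (by positivity)]
  nlinarith

lemma IsAdaptedCurve.ito_mem_lpMeas (hA : IsAdaptedCurve P 𝓕 a b A)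
    (hw : IsL2Integrator P 𝓕 T C w) (ha : 0 ≤ a) (hab : a ≤ b) (hb : b ≤ T) :
    ito P 𝓕 T w a b A ∈ lpMeas ℝ ℝ (𝓕 b) 2 P := by
  have := meshFilter_neBot hab
  refine (isClosed_lpMeas b).mem_of_tendsto (hA.tendsto_stepSum hw ha hab hb)
    (Eventually.of_forall fun π => Submodule.sum_mem _ fun j hj => ?_)
  rw [Finset.mem_range] at hj
  exact lpMeas_mono (π.pt_le_right hj) (increment_mem hw (ha.trans (π.left_le_pt hj.le))
    (π.pt_lt j hj).le ((π.pt_le_right hj).trans hb) (hA.adapted _ (π.pt_mem_Icc hj.le)))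

/-- Passing to a subsequence along which both families converge almost everywhere makes any
integrability of `η` unnecessary. -/
lemma ae_eq_mul_of_tendsto {ι : Type*} {l : Filter ι} [l.NeBot] [l.IsCountablyGenerated]
    {x y : ι → Lp ℝ 2 P} {x₀ y₀ : Lp ℝ 2 P} (hx : Tendsto x l (𝓝 x₀)) (hy : Tendsto y l (𝓝 y₀))
    {η : Ω → ℝ} (h : ∀ i, y i =ᵐ[P] fun ω => η ω * x i ω) : y₀ =ᵐ[P] fun ω => η ω * x₀ ω := by
  obtain ⟨u, hu⟩ := l.exists_seq_tendsto
  obtain ⟨n, hn, hxn⟩ := (tendstoInMeasure_of_tendsto_Lp (hx.comp hu)).exists_seq_tendsto_ae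
  obtain ⟨k, hk, hyk⟩ := (tendstoInMeasure_of_tendsto_Lp
    ((hy.comp hu).comp hn.tendsto_atTop)).exists_seq_tendsto_ae
  have hall : ∀ᵐ ω ∂P, ∀ j, y (u (n (k j))) ω = η ω * x (u (n (k j))) ω :=
    ae_all_iff.2 fun j => h _
  filter_upwards [hxn, hyk, hall] with ω h1 h2 h3
  refine tendsto_nhds_unique h2 ?_
  simp only [Function.comp_apply, h3]
  exact (h1.comp hk.tendsto_atTop).const_mul _

lemma coeFn_stepSum (hw : IsL2Integrator P 𝓕 T C w) (ha : 0 ≤ a) (hb : b ≤ T)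
    (π : Partition a b) {c : ℕ → Lp ℝ 2 P}
    (hc : ∀ j < π.N, c j ∈ lpMeas ℝ ℝ (𝓕 (π.pt j)) 2 P) :
    stepSum P w π c =ᵐ[P] fun ω => ∑ j ∈ Finset.range π.N,
      c j ω * (w (π.pt (j + 1)) ω - w (π.pt j) ω) := by
  have h : ∀ᵐ ω ∂P, ∀ j ∈ Finset.range π.N, increment P w (π.pt j) (π.pt (j + 1)) (c j) ω =
      c j ω * (w (π.pt (j + 1)) ω - w (π.pt j) ω) := by
    refine (Finset.eventually_all _).2 fun j hj => ?_
    rw [Finset.mem_range] at hj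
    exact coeFn_increment hw (ha.trans (π.left_le_pt hj.le)) (π.pt_lt j hj).le
      ((π.pt_le_right hj).trans hb) (hc j hj)
  filter_upwards [h, Lp.coeFn_finsetSum (Finset.range π.N)
    fun j => increment P w (π.pt j) (π.pt (j + 1)) (c j)] with ω h1 h2
  rw [stepSum, h2, Finset.sum_apply]
  exact Finset.sum_congr rfl h1

lemma IsAdaptedCurve.ito_ae_eq_mul {A' : ℝ → Lp ℝ 2 P} (hA : IsAdaptedCurve P 𝓕 a b A)
    (hA' : IsAdaptedCurve P 𝓕 a b A') (hw : IsL2Integrator P 𝓕 T C w) (ha : 0 ≤ a) (hab : a ≤ b)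
    (hb : b ≤ T) {η : Ω → ℝ} (h : ∀ s ∈ Icc a b, A' s =ᵐ[P] fun ω => η ω * A s ω) :
    ito P 𝓕 T w a b A' =ᵐ[P] fun ω => η ω * ito P 𝓕 T w a b A ω := by
  have := meshFilter_neBot hab
  refine ae_eq_mul_of_tendsto (hA.tendsto_stepSum hw ha hab hb)
    (hA'.tendsto_stepSum hw ha hab hb) fun π => ?_
  have hall : ∀ᵐ ω ∂P, ∀ j ∈ Finset.range π.N, A' (π.pt j) ω = η ω * A (π.pt j) ω :=
    (Finset.eventually_all _).2 fun j hj =>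
      h _ (π.pt_mem_Icc (Finset.mem_range.1 hj).le)
  filter_upwards [hall, coeFn_stepSum hw ha hb π fun j hj =>
      hA.adapted _ (π.pt_mem_Icc (j := j) hj.le),
    coeFn_stepSum hw ha hb π fun j hj => hA'.adapted _ (π.pt_mem_Icc (j := j) hj.le)]
    with ω h1 h2 h3
  rw [h2, h3, Finset.mul_sum]
  refine Finset.sum_congr rfl fun j hj => ?_
  rw [h1 j hj, mul_assoc]

end Ito

/-! ### Comparison with the Ito integral of processes -/

section Comparison

variable {P : Measure Ω} {𝓕 : Filtration ℝ mΩ} {T : ℝ} {C : ℝ≥0} {w : ℝ → Ω → ℝ} {a b : ℝ}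
  {A : ℝ → Lp ℝ 2 P}

lemma eLpNorm_eq_enorm {g : Ω → ℝ} {x : Lp ℝ 2 P} (h : g =ᵐ[P] x) : eLpNorm g 2 P = ‖x‖ₑ := by
  rw [eLpNorm_congr_ae h, Lp.enorm_def]

lemma lintegral_enorm_sq_eq {g : Ω → ℝ} {x : Lp ℝ 2 P} (h : g =ᵐ[P] x) :
    ∫⁻ ω, ‖g ω‖ₑ ^ 2 ∂P = ‖x‖ₑ ^ 2 := by
  rw [← eLpNorm_eq_enorm h, eLpNorm_eq_lintegral_rpow_enorm_toReal (by norm_num) (by norm_num),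
    ← ENNReal.rpow_natCast, ← ENNReal.rpow_mul]
  norm_num

lemma tendsto_iff_enorm_sub {ι E : Type*} [SeminormedAddCommGroup E] {l : Filter ι} {x : ι → E}
    {x₀ : E} : Tendsto x l (𝓝 x₀) ↔ Tendsto (fun i => ‖x i - x₀‖ₑ) l (𝓝 0) := by
  rw [tendsto_iff_edist_tendsto_0]
  simp only [edist_eq_enorm_sub]

lemma ennreal_add_sq_le (x y : ℝ≥0∞) : (x + y) ^ 2 ≤ 4 * x ^ 2 + 4 * y ^ 2 := by
  have key : ∀ u v : ℝ≥0∞, u ≤ v → (u + v) ^ 2 ≤ 4 * v ^ 2 := fun u v h => by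
    calc (u + v) ^ 2 ≤ (v + v) ^ 2 := by gcongr
      _ = 4 * v ^ 2 := by ring
  rcases le_total x y with h | h
  · exact (key x y h).trans le_add_self
  · rw [add_comm x y]
    exact (key y x h).trans le_self_add

/-- The sequence of values of a step process as elements of `L²`. -/
def toLpSeq (P : Measure Ω) (c : ℕ → Ω → ℝ) (j : ℕ) : Lp ℝ 2 P :=
  open Classical in if h : MemLp (c j) 2 P then h.toLp else 0

lemma coeFn_toLpSeq {c : ℕ → Ω → ℝ} {j : ℕ} (h : MemLp (c j) 2 P) :
    toLpSeq P c j =ᵐ[P] c j := by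
  rw [toLpSeq, dif_pos h]
  exact MemLp.coeFn_toLp _

lemma coeFn_stepCurve (π : Partition a b) {c : ℕ → Ω → ℝ} {x : ℕ → Lp ℝ 2 P}
    (h : ∀ j < π.N, c j =ᵐ[P] x j) (s : ℝ) : stepFun π c s =ᵐ[P] (stepCurve π x s : Lp ℝ 2 P) := by
  by_cases hs : s ∈ Ico a b
  · obtain ⟨j, hj, hsj⟩ := π.exists_mem_Ico hs
    rw [stepCurve, π.sum_indicator_of_mem _ hj hsj]
    filter_upwards [h j hj] with ω hω
    rw [stepFun, π.sum_indicator_of_mem (fun k => c k ω) hj hsj, hω]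
  · rw [stepCurve, π.sum_indicator_of_notMem _ hs]
    filter_upwards [Lp.coeFn_zero ℝ 2 P] with ω hω
    rw [stepFun, π.sum_indicator_of_notMem (fun k => c k ω) hs, hω, Pi.zero_apply]

lemma coeFn_stepSum_of_ae_eq (hw : IsL2Integrator P 𝓕 T C w) (ha : 0 ≤ a) (hb : b ≤ T)
    (π : Partition a b) {c : ℕ → Ω → ℝ} {x : ℕ → Lp ℝ 2 P}
    (hx : ∀ j < π.N, x j ∈ lpMeas ℝ ℝ (𝓕 (π.pt j)) 2 P) (h : ∀ j < π.N, c j =ᵐ[P] x j) :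
    (fun ω => ∑ j ∈ Finset.range π.N, c j ω * (w (π.pt (j + 1)) ω - w (π.pt j) ω)) =ᵐ[P]
      stepSum P w π x := by
  have hall : ∀ᵐ ω ∂P, ∀ j ∈ Finset.range π.N, c j ω = x j ω :=
    (Finset.eventually_all _).2 fun j hj => h j (Finset.mem_range.1 hj)
  filter_upwards [hall, coeFn_stepSum hw ha hb π hx] with ω h1 h2
  rw [h2]
  exact Finset.sum_congr rfl fun j hj => by rw [h1 j hj]

/-- The given step processes and the samples of `A` along a fine partition are both elementary, so
their integrals differ by no more than their `L²([a, b] × Ω)` distance allows. The limits are taken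
in the given sequence, then in the mesh, then in the uniform error `ε`. -/
lemma IsItoIntegral.ae_eq_ito {ξ : ℝ → Ω → ℝ} {X : Ω → ℝ}
    (h : IsItoIntegral P 𝓕 w a b ξ X) (hA : IsAdaptedCurve P 𝓕 a b A)
    (hw : IsL2Integrator P 𝓕 T C w) (ha : 0 ≤ a) (hab : a ≤ b) (hb : b ≤ T)
    (hξ : ∀ s ∈ Icc a b, ξ s =ᵐ[P] A s) : X =ᵐ[P] ito P 𝓕 T w a b A := by
  obtain ⟨-, hX, π, c, hc, hstep, hsum⟩ := h
  have hcx : ∀ n, ∀ j < (π n).N, c n j =ᵐ[P] toLpSeq P (c n) j := fun n j hj =>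
    (coeFn_toLpSeq (hc n j hj).2).symm
  have hcm : ∀ n, ∀ j < (π n).N, toLpSeq P (c n) j ∈ lpMeas ℝ ℝ (𝓕 ((π n).pt j)) 2 P :=
    fun n j hj => by
      rw [mem_lpMeas_iff_aestronglyMeasurable]
      exact ((hc n j hj).1.stronglyMeasurable.aestronglyMeasurable).congr (hcx n j hj)
  let x : ℕ → Lp ℝ 2 P := fun n => stepSum P w (π n) (toLpSeq P (c n))
  have hx : Tendsto x atTop (𝓝 hX.toLp) := by
    rw [tendsto_iff_enorm_sub]
    refine hsum.congr fun n => eLpNorm_eq_enorm ?_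
    filter_upwards [coeFn_stepSum_of_ae_eq hw ha hb (π n) (hcm n) (hcx n), hX.coeFn_toLp,
      Lp.coeFn_sub (x n) hX.toLp] with ω h1 h2 h3
    rw [h3, Pi.sub_apply, ← h1, h2]
  let D : ℕ → ℝ≥0∞ := fun n =>
    ∫⁻ s in Icc a b, ‖stepCurve (π n) (toLpSeq P (c n)) s - A s‖ₑ ^ 2
  have hD : Tendsto D atTop (𝓝 0) := by
    refine hstep.congr fun n => setLIntegral_congr_fun measurableSet_Icc fun s hs => ?_
    refine lintegral_enorm_sq_eq ?_
    filter_upwards [coeFn_stepCurve (π n) (hcx n) s, hξ s hs,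
      Lp.coeFn_sub (stepCurve (π n) (toLpSeq P (c n)) s) (A s)] with ω h1 h2 h3
    rw [h3, Pi.sub_apply, ← h1, h2]
  have hbound : ∀ ε > 0, ∀ π' : Partition a b,
      (∀ s, ‖(Ico a b).indicator A s - stepCurve π' (fun j => A (π'.pt j)) s‖ ≤ ε) →
      ‖hX.toLp - stepSum P w π' (fun j => A (π'.pt j))‖ₑ ^ 2 ≤
        C * (4 * ENNReal.ofReal ε ^ 2 * ENNReal.ofReal (b - a)) := by
    intro ε hε π' hπ'
    have h1 : ∀ n, ‖x n - stepSum P w π' (fun j => A (π'.pt j))‖ₑ ^ 2 ≤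
        C * (4 * D n + 4 * ENNReal.ofReal ε ^ 2 * ENNReal.ofReal (b - a)) := by
      intro n
      have hq := hw.bound _ (sub_mem (step_mem_elementary ha hb (π n) (hcm n))
        (hA.step_mem ha hb π'))
      refine hq.trans ?_
      gcongr
      set F : ℝ → Lp ℝ 2 P := stepCurve (π n) (toLpSeq P (c n)) -
        stepCurve π' (fun j => A (π'.pt j)) with hF
      -- Both step curves vanish off `[a, b)`, so the bound over `[0, T)` only sees `[a, b)`.
      have hsupp : ∀ s, s ∉ Ico a b → F s = 0 := fun s hs => by
        rw [hF, Pi.sub_apply, stepCurve, stepCurve, Partition.sum_indicator_of_notMem _ _ hs,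
          Partition.sum_indicator_of_notMem _ _ hs, sub_zero]
      calc ∫⁻ s in Ico 0 T, ‖F s‖ₑ ^ 2 ≤ ∫⁻ s, (Icc a b).indicator (fun s => ‖F s‖ₑ ^ 2) s := by
            refine (setLIntegral_le_lintegral _ _).trans (lintegral_mono fun s => ?_)
            by_cases hs : s ∈ Icc a b
            · rw [indicator_of_mem hs]
            · rw [hsupp s fun h => hs (Ico_subset_Icc_self h)]
              simp
        _ = ∫⁻ s in Ico a b, ‖F s‖ₑ ^ 2 := by
            rw [lintegral_indicator measurableSet_Icc, setLIntegral_congr Ico_ae_eq_Icc]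
        _ ≤ ∫⁻ s in Ico a b, (4 * ‖stepCurve (π n) (toLpSeq P (c n)) s - A s‖ₑ ^ 2 +
              4 * ENNReal.ofReal ε ^ 2) := by
            refine setLIntegral_mono' measurableSet_Ico fun s hs => ?_
            have h2 := hπ' s
            rw [indicator_of_mem hs] at h2
            have h3 : F s = (stepCurve (π n) (toLpSeq P (c n)) s - A s) +
                (A s - stepCurve π' (fun j => A (π'.pt j)) s) := by
              rw [hF, Pi.sub_apply]; abel
            rw [h3]
            calc _ ≤ (‖stepCurve (π n) (toLpSeq P (c n)) s - A s‖ₑ + ENNReal.ofReal ε) ^ 2 := by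
                  gcongr
                  refine (enorm_add_le _ _).trans ?_
                  gcongr
                  rw [← ofReal_norm]
                  exact ENNReal.ofReal_le_ofReal h2
              _ ≤ _ := ennreal_add_sq_le _ _
        _ = 4 * D n + 4 * ENNReal.ofReal ε ^ 2 * ENNReal.ofReal (b - a) := by
            rw [lintegral_add_right _ measurable_const, setLIntegral_const, Real.volume_Ico,
              lintegral_const_mul' _ _ (by norm_num), setLIntegral_congr Ico_ae_eq_Icc]
    have hl : Tendsto (fun n => ‖x n - stepSum P w π' (fun j => A (π'.pt j))‖ₑ ^ 2) atTop
        (𝓝 (‖hX.toLp - stepSum P w π' (fun j => A (π'.pt j))‖ₑ ^ 2)) :=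
      (ENNReal.continuous_pow 2).continuousAt.tendsto.comp (hx.sub_const _).enorm
    have hr : Tendsto (fun n => C * (4 * D n + 4 * ENNReal.ofReal ε ^ 2 *
        ENNReal.ofReal (b - a))) atTop
        (𝓝 (C * (4 * 0 + 4 * ENNReal.ofReal ε ^ 2 * ENNReal.ofReal (b - a)))) :=
      ENNReal.Tendsto.const_mul ((ENNReal.Tendsto.const_mul hD (Or.inr (by norm_num))).add_const _)
        (Or.inr ENNReal.coe_ne_top)
    simpa using le_of_tendsto_of_tendsto' hl hr h1
  have hne := meshFilter_neBot hab
  have hbound' : ∀ ε > 0, ‖hX.toLp - ito P 𝓕 T w a b A‖ₑ ^ 2 ≤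
      C * (4 * ENNReal.ofReal ε ^ 2 * ENNReal.ofReal (b - a)) := fun ε hε => by
    have hl : Tendsto (fun π' : Partition a b =>
        ‖hX.toLp - stepSum P w π' (fun j => A (π'.pt j))‖ₑ ^ 2) (meshFilter a b)
        (𝓝 (‖hX.toLp - ito P 𝓕 T w a b A‖ₑ ^ 2)) :=
      (ENNReal.continuous_pow 2).continuousAt.tendsto.comp
        ((hA.tendsto_stepSum hw ha hab hb).const_sub _).enorm
    exact le_of_tendsto hl ((eventually_norm_sub_stepCurve_le hA.cont hε).mono
      fun π' h => hbound ε hε π' h)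
  have hlim : Tendsto (fun ε : ℝ => C * (4 * ENNReal.ofReal ε ^ 2 * ENNReal.ofReal (b - a)))
      (𝓝[>] 0) (𝓝 (C * (4 * 0 ^ 2 * ENNReal.ofReal (b - a)))) := by
    refine ENNReal.Tendsto.const_mul (ENNReal.Tendsto.mul_const (ENNReal.Tendsto.const_mul
      ((ENNReal.continuous_pow 2).continuousAt.tendsto.comp ?_) (Or.inr (by norm_num)))
      (Or.inr ENNReal.ofReal_ne_top)) (Or.inr ENNReal.coe_ne_top)
    have := (ENNReal.continuous_ofReal.tendsto 0).mono_left
      (nhdsWithin_le_nhds (s := Ioi (0 : ℝ)))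
    simpa using this
  have hzero := ge_of_tendsto hlim (eventually_mem_nhdsWithin.mono fun ε hε => hbound' ε hε)
  have heq : hX.toLp = ito P 𝓕 T w a b A := by
    simpa [sub_eq_zero] using hzero
  rw [← heq]
  exact hX.coeFn_toLp.symm

/-- The step processes required by the definition are the samples of `ξ` itself along partitions
with mesh tending to zero. -/
lemma IsAdaptedCurve.isItoIntegral {ξ : ℝ → Ω → ℝ} {X : Ω → ℝ}
    (hA : IsAdaptedCurve P 𝓕 a b A) (hw : IsL2Integrator P 𝓕 T C w) (ha : 0 ≤ a) (hab : a ≤ b)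
    (hb : b ≤ T) (hM : MemM2 P 𝓕 a b ξ) (hξ : ∀ s ∈ Icc a b, ξ s =ᵐ[P] A s)
    (hX : X =ᵐ[P] ito P 𝓕 T w a b A) : IsItoIntegral P 𝓕 w a b ξ X := by
  have hne := meshFilter_neBot hab
  obtain ⟨π, hπ⟩ := (meshFilter a b).exists_seq_tendsto
  refine ⟨hM, (memLp_congr_ae hX).2 (Lp.memLp _), π, fun n j => ξ ((π n).pt j),
    fun n j hj => ?_, ?_, ?_⟩
  · have := (π n).pt_mem_Icc hj.le
    exact ⟨hM.adapted _ this, hM.memLp _ this⟩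
  · have hle : ∀ ε > 0, ∀ᶠ n in atTop, ∫⁻ s in Icc a b,
        ∫⁻ ω, ‖stepFun (π n) (fun j => ξ ((π n).pt j)) s ω - ξ s ω‖ₑ ^ 2 ∂P ≤
        ENNReal.ofReal ε ^ 2 * ENNReal.ofReal (b - a) := by
      intro ε hε
      filter_upwards [hπ.eventually (eventually_norm_sub_stepCurve_le hA.cont hε)] with n hn
      rw [setLIntegral_congr Ico_ae_eq_Icc.symm, ← Real.volume_Ico, ← setLIntegral_const]
      refine setLIntegral_mono' measurableSet_Ico fun s hs => ?_
      have h1 := hn s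
      rw [indicator_of_mem hs, norm_sub_rev] at h1
      rw [lintegral_enorm_sq_eq (x := stepCurve (π n) (fun j => A ((π n).pt j)) s - A s)]
      · gcongr
        rw [← ofReal_norm]
        exact ENNReal.ofReal_le_ofReal h1
      · filter_upwards [coeFn_stepCurve (π n) (fun j hj => hξ _ ((π n).pt_mem_Icc
          (j := j) hj.le)) s, hξ s (Ico_subset_Icc_self hs),
          Lp.coeFn_sub (stepCurve (π n) (fun j => A ((π n).pt j)) s) (A s)] with ω h2 h3 h4
        rw [h4, Pi.sub_apply, ← h2, h3]
    have hlim : Tendsto (fun ε : ℝ => ENNReal.ofReal ε ^ 2 * ENNReal.ofReal (b - a))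
        (𝓝[>] 0) (𝓝 0) := by
      have h1 := (ENNReal.continuous_ofReal.tendsto 0).mono_left
        (nhdsWithin_le_nhds (s := Ioi (0 : ℝ)))
      have h2 := ENNReal.Tendsto.mul_const (b := ENNReal.ofReal (b - a))
        ((ENNReal.continuous_pow 2).continuousAt.tendsto.comp h1) (Or.inr ENNReal.ofReal_ne_top)
      simpa using h2
    rw [ENNReal.tendsto_nhds_zero]
    intro δ hδ
    obtain ⟨ε, h1, h2⟩ :=
      (((ENNReal.tendsto_nhds_zero.1 hlim) δ hδ).and eventually_mem_nhdsWithin).exists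
    exact (hle ε h2).mono fun n hn => hn.trans h1
  · have h1 := (tendsto_iff_enorm_sub.1 (hA.tendsto_stepSum hw ha hab hb)).comp hπ
    refine h1.congr fun n => (eLpNorm_eq_enorm ?_).symm
    filter_upwards [coeFn_stepSum_of_ae_eq hw ha hb (π n)
      (fun j hj => hA.adapted _ ((π n).pt_mem_Icc (j := j) hj.le))
      (fun j hj => hξ _ ((π n).pt_mem_Icc (j := j) hj.le)), hX,
      Lp.coeFn_sub (stepSum P w (π n) fun j => A ((π n).pt j)) (ito P 𝓕 T w a b A)]
      with ω h2 h3 h4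
    rw [h4, Pi.sub_apply, ← h2, h3]

lemma memLp_of_ae_eq {g : Ω → ℝ} {x : Lp ℝ 2 P} (h : g =ᵐ[P] x) : MemLp g 2 P :=
  (memLp_congr_ae h).2 (Lp.memLp x)

lemma memM2_of_ae_eq {ξ : ℝ → Ω → ℝ} (hA : ContinuousOn A (Icc a b))
    (hm : Measurable (fun p : Icc a b × Ω => ξ p.1 p.2))
    (had : ∀ s ∈ Icc a b, Measurable[𝓕 s] (ξ s)) (hξ : ∀ s ∈ Icc a b, ξ s =ᵐ[P] A s) :
    MemM2 P 𝓕 a b ξ := by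
  refine ⟨hm, had, ?_, fun s hs => memLp_of_ae_eq (hξ s hs)⟩
  obtain ⟨M, hM⟩ := isCompact_Icc.exists_bound_of_continuousOn hA
  calc ∫⁻ s in Icc a b, ∫⁻ ω, ‖ξ s ω‖ₑ ^ 2 ∂P ≤ ∫⁻ _ in Icc a b, ENNReal.ofReal M ^ 2 := by
        refine setLIntegral_mono' measurableSet_Icc fun s hs => ?_
        rw [lintegral_enorm_sq_eq (hξ s hs), ← ofReal_norm]
        gcongr
        exact hM s hs
    _ < ∞ := by
        rw [setLIntegral_const, Real.volume_Icc]
        exact ENNReal.mul_lt_top (by simp) ENNReal.ofReal_lt_top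

/-- A mean-square continuous adapted curve is represented by a jointly measurable adapted
process. -/
lemma IsAdaptedCurve.exists_memM2 (hA : IsAdaptedCurve P 𝓕 a b A) (hab : a ≤ b) :
    ∃ Y : ℝ → Ω → ℝ, MemM2 P 𝓕 a b Y ∧ ∀ s ∈ Icc a b, Y s =ᵐ[P] A s := by
  have hy : ∀ s ∈ Icc a b, ∃ y : Ω → ℝ, Measurable[𝓕 s] y ∧ y =ᵐ[P] A s := fun s hs => by
    obtain ⟨y, h1, h2⟩ := mem_lpMeas_iff_aestronglyMeasurable.1 (hA.adapted s hs)
    exact ⟨y, h1.measurable, h2.symm⟩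
  choose! y hym hyA using hy
  have hne := meshFilter_neBot hab
  -- Geometric errors are summable, which makes the whole sequence converge almost everywhere at
  -- each time, with the same partitions for all times.
  have hπ : ∀ k : ℕ, ∃ π : Partition a b, ∀ s,
      ‖(Ico a b).indicator A s - stepCurve π (fun j => A (π.pt j)) s‖ ≤ (1 / 2) ^ k := fun k =>
    (eventually_norm_sub_stepCurve_le hA.cont (by positivity)).exists
  choose π hπ using hπ
  -- A step process vanishes at the right end point `b`, so the value there is added separately.
  let Z : ℕ → ℝ → Ω → ℝ := fun k s ω => stepFun (π k) (fun j => y ((π k).pt j)) s ω +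
    ({b} : Set ℝ).indicator (fun _ => y b ω) s
  let B : ℕ → ℝ → Lp ℝ 2 P := fun k s => stepCurve (π k) (fun j => A ((π k).pt j)) s +
    ({b} : Set ℝ).indicator (fun _ => A b) s
  have hZB : ∀ k s, Z k s =ᵐ[P] B k s := fun k s => by
    have hb : (fun ω => ({b} : Set ℝ).indicator (fun _ => y b ω) s) =ᵐ[P]
        (({b} : Set ℝ).indicator (fun _ => A b) s : Lp ℝ 2 P) := by
      by_cases hs : s ∈ ({b} : Set ℝ)
      · simpa only [indicator_of_mem hs] using hyA b ⟨hab, le_rfl⟩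
      · simp only [indicator_of_notMem hs]
        exact (Lp.coeFn_zero ℝ 2 P).symm
    filter_upwards [coeFn_stepCurve (π k) (fun j hj => hyA _ ((π k).pt_mem_Icc (j := j) hj.le)) s,
      hb, Lp.coeFn_add (stepCurve (π k) (fun j => A ((π k).pt j)) s)
        (({b} : Set ℝ).indicator (fun _ => A b) s)] with ω h1 h2 h3
    rw [h3, Pi.add_apply, ← h1, ← h2]
  have hBA : ∀ k, ∀ s ∈ Icc a b, ‖B k s - A s‖ ≤ (1 / 2) ^ k := fun k s hs => by
    rcases hs.2.eq_or_lt with rfl | hlt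
    · have h1 : stepCurve (π k) (fun j => A ((π k).pt j)) s = 0 :=
        (π k).sum_indicator_of_notMem _ fun h => lt_irrefl _ h.2
      simp only [B, h1, mem_singleton_iff, indicator_of_mem, zero_add, sub_self, norm_zero]
      positivity
    · have h1 := hπ k s
      rw [indicator_of_mem (show s ∈ Ico a b from ⟨hs.1, hlt⟩), norm_sub_rev] at h1
      simpa only [B, indicator_of_notMem (show s ∉ ({b} : Set ℝ) from hlt.ne), add_zero] using h1
  -- An upper limit in `EReal` is defined for every `ω`, so `Y s` is measurable for `𝓕 s` itself,
  -- although null sets need not belong to `𝓕 s`. For `s` in `[a, b]` the default of `toReal` at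
  -- infinite values matters only on a null set.
  let Y : ℝ → Ω → ℝ := fun s ω => (limsup (fun k => ((Z k s ω : ℝ) : EReal)) atTop).toReal
  have hYA : ∀ s ∈ Icc a b, Y s =ᵐ[P] A s := by
    intro s hs
    have hlim : Tendsto (fun k => B k s) atTop (𝓝 (A s)) := by
      rw [tendsto_iff_norm_sub_tendsto_zero]
      exact squeeze_zero (fun _ => norm_nonneg _) (fun k => hBA k s hs)
        (tendsto_pow_atTop_nhds_zero_of_lt_one (by norm_num) (by norm_num))
    obtain ⟨u, hu, huA⟩ := (tendstoInMeasure_of_tendsto_Lp hlim).exists_seq_tendsto_ae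
    have hconv : ∀ᵐ ω ∂P, ∃ l, Tendsto (fun k => B k s ω) atTop (𝓝 l) := by
      -- The distance is at most `2 * (1 / 2) ^ N`; the factor `3` gives the strict inequality
      -- needed here.
      refine Lp.ae_tendsto_of_cauchy_eLpNorm (p := 2) (fun k => (Lp.aestronglyMeasurable _))
        (by norm_num) (B := fun N => 3 * (2⁻¹ : ℝ≥0∞) ^ N) ?_ ?_
      · rw [ENNReal.tsum_mul_left, ENNReal.tsum_geometric]
        refine ENNReal.mul_ne_top (by norm_num) ?_
        simp
      · intro N n m hn hm
        have h1 : ‖B n s - B m s‖ ≤ 2 * (1 / 2) ^ N := by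
          have h2 : B n s - B m s = (B n s - A s) - (B m s - A s) := by abel
          rw [h2]
          refine (norm_sub_le _ _).trans ?_
          have h3 : ((1 : ℝ) / 2) ^ n ≤ (1 / 2) ^ N :=
            pow_le_pow_of_le_one (by norm_num) (by norm_num) hn
          have h4 : ((1 : ℝ) / 2) ^ m ≤ (1 / 2) ^ N :=
            pow_le_pow_of_le_one (by norm_num) (by norm_num) hm
          linarith [hBA n s hs, hBA m s hs]
        rw [eLpNorm_eq_enorm (Lp.coeFn_sub _ _).symm, ← ofReal_norm]
        have h5 : (3 * (2⁻¹ : ℝ≥0∞) ^ N) = ENNReal.ofReal (3 * (1 / 2) ^ N) := by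
          rw [ENNReal.ofReal_mul (by norm_num), ENNReal.ofReal_pow (by norm_num), one_div,
            ENNReal.ofReal_inv_of_pos (by norm_num)]
          norm_num
        rw [h5]
        refine (ENNReal.ofReal_lt_ofReal_iff (by positivity)).2 (h1.trans_lt ?_)
        have : (0 : ℝ) < (1 / 2) ^ N := by positivity
        linarith
    have hall : ∀ᵐ ω ∂P, ∀ k, Z k s ω = B k s ω := ae_all_iff.2 fun k => hZB k s
    filter_upwards [huA, hconv, hall] with ω h1 ⟨l, hl⟩ h3
    have h4 : l = A s ω := tendsto_nhds_unique (hl.comp hu.tendsto_atTop) h1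
    have h5 : Tendsto (fun k => ((Z k s ω : ℝ) : EReal)) atTop (𝓝 ((A s ω : ℝ) : EReal)) := by
      simp only [h3]
      exact (continuous_coe_real_ereal.tendsto _).comp (h4 ▸ hl)
    simp only [Y, h5.limsup_eq, EReal.toReal_coe]
  refine ⟨Y, memM2_of_ae_eq hA.cont ?_ ?_ hYA, hYA⟩
  · refine measurable_ereal_toReal.comp (Measurable.limsup fun k =>
      measurable_coe_real_ereal.comp (Measurable.add ?_ ?_))
    · refine Finset.measurable_fun_sum _ fun j hj => ?_
      rw [Finset.mem_range] at hj
      have hm : Measurable (y ((π k).pt j)) :=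
        (hym _ ((π k).pt_mem_Icc hj.le)).mono (𝓕.le _) le_rfl
      exact Measurable.indicator (hm.comp measurable_snd)
        ((measurable_subtype_coe.comp measurable_fst) measurableSet_Ico)
    · have hm : Measurable (y b) := (hym b ⟨hab, le_rfl⟩).mono (𝓕.le _) le_rfl
      exact Measurable.indicator (hm.comp measurable_snd)
        ((measurable_subtype_coe.comp measurable_fst) (measurableSet_singleton b))
  · intro s hs
    refine measurable_ereal_toReal.comp (Measurable.limsup fun k =>
      measurable_coe_real_ereal.comp (Measurable.add ?_ ?_))
    · refine Finset.measurable_fun_sum _ fun j hj => ?_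
      rw [Finset.mem_range] at hj
      by_cases hsj : s ∈ Ico ((π k).pt j) ((π k).pt (j + 1))
      · simp only [indicator_of_mem hsj]
        exact (hym _ ((π k).pt_mem_Icc hj.le)).mono (𝓕.mono hsj.1) le_rfl
      · simp only [indicator_of_notMem hsj]
        exact measurable_const
    · by_cases hsb : s = b
      · subst hsb
        simpa using hym s hs
      · simp only [indicator_of_notMem (show s ∉ ({b} : Set ℝ) from hsb)]
        exact measurable_const

end Comparison

/-! ### Simplices -/

/-- The last coordinate of a tuple, or `b` for the empty tuple. -/
def lastOr : (r : ℕ) → (Fin r → ℝ) → ℝ → ℝ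
  | 0, _, b => b
  | r + 1, v, _ => v (Fin.last r)

section Simplex

variable {r : ℕ} {u b x : ℝ} {v : Fin r → ℝ}

lemma lastOr_le (hv : v ∈ simplex r u b) : lastOr r v b ≤ b := by
  cases r with
  | zero => exact le_rfl
  | succ r => exact (hv.2 _).2

lemma le_lastOr (hv : v ∈ simplex r u b) (hub : u ≤ b) : u ≤ lastOr r v b := by
  cases r with
  | zero => exact hub
  | succ r => exact (hv.2 _).1

lemma lastOr_le_apply (hv : v ∈ simplex r u b) (j : Fin r) : lastOr r v b ≤ v j := by
  cases r with
  | zero => exact j.elim0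
  | succ r => exact hv.1 (Fin.le_last j)

@[simp]
lemma lastOr_snoc (v : Fin r → ℝ) (x b : ℝ) :
    lastOr (r + 1) (Fin.snoc (α := fun _ => ℝ) v x) b = x := by
  simp [lastOr]

lemma snoc_mem_simplex (hv : v ∈ simplex r u b) (hx : x ∈ Icc u (lastOr r v b)) :
    Fin.snoc (α := fun _ => ℝ) v x ∈ simplex (r + 1) u b := by
  constructor
  · intro i j hij
    induction j using Fin.lastCases with
    | last =>
      induction i using Fin.lastCases with
      | last => exact le_rfl
      | cast i => simpa using hx.2.trans (lastOr_le_apply hv i)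
    | cast j =>
      induction i using Fin.lastCases with
      | last => exact absurd hij (not_le.2 (Fin.castSucc_lt_last j))
      | cast i => simpa using hv.1 (by simpa using hij)
  · intro j
    induction j using Fin.lastCases with
    | last => simpa using And.intro hx.1 (hx.2.trans (lastOr_le hv))
    | cast j => simpa using hv.2 j

lemma init_mem_simplex {v : Fin (r + 1) → ℝ} (hv : v ∈ simplex (r + 1) u b) :
    Fin.init v ∈ simplex r u b :=
  ⟨fun _ _ hij => hv.1 (by simpa using hij), fun j => hv.2 j.castSucc⟩

lemma mem_simplex_of_le_lastOr {s : ℝ} (hv : v ∈ simplex r s b) (hu : u ≤ lastOr r v b) :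
    v ∈ simplex r u b :=
  ⟨hv.1, fun j => ⟨hu.trans (lastOr_le_apply hv j), (hv.2 j).2⟩⟩

lemma simplex_mono {u' b' : ℝ} (hu : u ≤ u') (hb : b' ≤ b) : simplex r u' b' ⊆ simplex r u b :=
  fun _ hv => ⟨hv.1, fun j => Icc_subset_Icc hu hb (hv.2 j)⟩

lemma cons_mem_simplex {t : ℝ} (ht : t ∈ Icc u b) (hv : v ∈ simplex r u t) :
    Fin.cons (α := fun _ => ℝ) t v ∈ simplex (r + 1) u b := by
  constructor
  · intro i j hij
    induction i using Fin.cases with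
    | zero =>
      induction j using Fin.cases with
      | zero => exact le_rfl
      | succ j => simpa using (hv.2 j).2
    | succ i =>
      induction j using Fin.cases with
      | zero => exact absurd hij (not_le.2 (Fin.succ_pos i))
      | succ j => simpa using hv.1 (by simpa using hij)
  · intro j
    induction j using Fin.cases with
    | zero => simpa using ht
    | succ j => simpa using And.intro (hv.2 j).1 ((hv.2 j).2.trans ht.2)

lemma isCompact_simplex (r : ℕ) (u b : ℝ) : IsCompact (simplex r u b) := by
  have h : IsCompact (univ.pi fun _ : Fin r => Icc u b) := isCompact_univ_pi fun _ => isCompact_Icc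
  refine h.of_isClosed_subset ?_ fun v hv j _ => hv.2 j
  have : simplex r u b = (⋂ i, ⋂ j, ⋂ _ : i ≤ j, {v : Fin r → ℝ | v j ≤ v i}) ∩
      ⋂ j, {v : Fin r → ℝ | v j ∈ Icc u b} := by
    ext v
    simp only [simplex, Antitone, mem_inter_iff, mem_iInter, mem_ofPred_eq]
  rw [this]
  refine IsClosed.inter ?_ (isClosed_iInter fun j => isClosed_Icc.preimage (continuous_apply j))
  exact isClosed_iInter fun i => isClosed_iInter fun j => isClosed_iInter fun _ =>
    isClosed_le (continuous_apply j) (continuous_apply i)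

lemma abs_lastOr_sub_le (v v' : Fin r → ℝ) (b : ℝ) :
    |lastOr r v b - lastOr r v' b| ≤ dist v v' := by
  cases r with
  | zero => simp [lastOr]
  | succ r => exact dist_le_pi_dist v v' (Fin.last r)

lemma dist_snoc_le (v v' : Fin r → ℝ) (x : ℝ) :
    dist (Fin.snoc (α := fun _ => ℝ) v x : Fin (r + 1) → ℝ) (Fin.snoc (α := fun _ => ℝ) v' x) ≤
      dist v v' := by
  refine (dist_pi_le_iff dist_nonneg).2 fun j => ?_
  induction j using Fin.lastCases with
  | last => simp
  | cast j => simpa using dist_le_pi_dist v v' j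

lemma dist_snoc_right_le (v : Fin r → ℝ) (x x' : ℝ) :
    dist (Fin.snoc (α := fun _ => ℝ) v x : Fin (r + 1) → ℝ) (Fin.snoc (α := fun _ => ℝ) v x') ≤
      |x - x'| := by
  refine (dist_pi_le_iff (abs_nonneg _)).2 fun j => ?_
  induction j using Fin.lastCases with
  | last => simp [Real.dist_eq]
  | cast j => simp

lemma continuous_snoc (v : Fin r → ℝ) :
    Continuous fun x : ℝ => (Fin.snoc (α := fun _ => ℝ) v x : Fin (r + 1) → ℝ) := by
  refine continuous_pi fun j => ?_
  induction j using Fin.lastCases with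
  | last => simpa using continuous_id'
  | cast j => simpa using continuous_const

lemma continuous_cons (t : ℝ) :
    Continuous fun v : Fin r → ℝ => (Fin.cons (α := fun _ => ℝ) t v : Fin (r + 1) → ℝ) := by
  refine continuous_pi fun j => ?_
  induction j using Fin.cases with
  | zero => simpa using continuous_const
  | succ j => simpa using continuous_apply j

lemma continuous_init :
    Continuous fun v : Fin (r + 1) → ℝ => (Fin.init v : Fin r → ℝ) :=
  continuous_pi fun j => continuous_apply j.castSucc

end Simplex

/-! ### Iterated integrals of random kernels -/

/-- A mean-square continuous random kernel on the simplex over `[u, b]`, measurable with respect to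
the past of its smallest variable. -/
structure IsKernel (P : Measure Ω) (𝓕 : Filtration ℝ mΩ) (r : ℕ) (Z : (Fin r → ℝ) → Lp ℝ 2 P)
    (u b : ℝ) : Prop where
  cont : ContinuousOn Z (simplex r u b)
  adapted : ∀ v ∈ simplex r u b, Z v ∈ lpMeas ℝ ℝ (𝓕 (lastOr r v b)) 2 P

/-- The iterated integral `∫_u^b ∫_u^{t₁} ⋯ ∫_u^{t_{r-1}} Z(t₁, …, t_r) dW_r ⋯ dW_1`. -/
def iter (P : Measure Ω) (𝓕 : Filtration ℝ mΩ) (T : ℝ) : (r : ℕ) → (Fin r → ℝ → Ω → ℝ) →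
    ((Fin r → ℝ) → Lp ℝ 2 P) → ℝ → ℝ → Lp ℝ 2 P
  | 0, _, Z, _, _ => Z Fin.elim0
  | r + 1, W, Z, u, b => iter P 𝓕 T r (Fin.init W) (fun v =>
      ito P 𝓕 T (W (Fin.last r)) u (lastOr r v b) fun x => Z (Fin.snoc v x)) u b

section Iter

variable {P : Measure Ω} {𝓕 : Filtration ℝ mΩ} {T : ℝ} {C : ℝ≥0} {r : ℕ} {u b : ℝ}

/-- The outermost integral of the iterated integral, split off. -/
lemma iter_succ (W : Fin (r + 1) → ℝ → Ω → ℝ) (Z : (Fin (r + 1) → ℝ) → Lp ℝ 2 P) (u b : ℝ) :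
    iter P 𝓕 T (r + 1) W Z u b = ito P 𝓕 T (W 0) u b fun t =>
      iter P 𝓕 T r (Fin.tail W) (fun v => Z (Fin.cons t v)) u t := by
  induction r generalizing b with
  | zero =>
    simp only [iter, lastOr]
    congr 1
    ext1 x
    congr 1
    ext1 j
    obtain rfl : j = Fin.last 0 := Fin.fin_one_eq_zero j
    rw [Fin.snoc_last]
    rfl
  | succ r ih =>
    rw [iter, ih]
    congr 1
    ext1 t
    rw [iter]
    congr 1
    ext1 v
    -- The default of `lastOr` matters here: if `v` is empty, the upper limit of the next variable
    -- is `t` and no longer `b`.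
    rw [show lastOr (r + 1) (Fin.cons (α := fun _ => ℝ) t v) b = lastOr r v t by
      cases r <;> rfl]
    congr 1
    ext1 x
    rw [Fin.cons_snoc_eq_snoc_cons]

lemma IsKernel.isAdaptedCurve {Z : (Fin (r + 1) → ℝ) → Lp ℝ 2 P}
    (hZ : IsKernel P 𝓕 (r + 1) Z u b) {v : Fin r → ℝ} (hv : v ∈ simplex r u b) :
    IsAdaptedCurve P 𝓕 u (lastOr r v b) fun x => Z (Fin.snoc v x) :=
  ⟨hZ.cont.comp (continuous_snoc v).continuousOn fun _ hx => snoc_mem_simplex hv hx,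
    fun x hx => by simpa using hZ.adapted _ (snoc_mem_simplex hv hx)⟩

/-- One `η` serves both as the uniform error and as the length of the exceptional interval in
`IsL2Integrator.norm_sq_le`. -/
lemma exists_pos_bound_lt (C T M : ℝ) {ε : ℝ} (hε : 0 < ε) :
    ∃ η > 0, C * (T * η ^ 2 + η * M ^ 2) < ε := by
  have h : Tendsto (fun η : ℝ => C * (T * η ^ 2 + η * M ^ 2)) (𝓝[>] 0)
      (𝓝 (C * (T * 0 ^ 2 + 0 * M ^ 2))) :=
    (Continuous.tendsto (by fun_prop) 0).mono_left nhdsWithin_le_nhds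
  obtain ⟨η, h1, h2⟩ := ((h.eventually (Iio_mem_nhds (by simpa using hε))).and
    eventually_mem_nhdsWithin).exists
  exact ⟨η, h2, h1⟩

/-- Moving `v` changes the integrand and the upper limit. On the common interval the integrands are
uniformly close; between the two upper limits there is a single integrand bounded by `M`, on an
interval no longer than the distance moved. -/
lemma IsKernel.ito {Z : (Fin (r + 1) → ℝ) → Lp ℝ 2 P} (hZ : IsKernel P 𝓕 (r + 1) Z u b)
    {w : ℝ → Ω → ℝ} (hw : IsL2Integrator P 𝓕 T C w) (hu : 0 ≤ u) (hub : u ≤ b) (hb : b ≤ T) :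
    IsKernel P 𝓕 r
      (fun v => ito P 𝓕 T w u (lastOr r v b) fun x => Z (Fin.snoc v x)) u b := by
  refine ⟨Metric.continuousOn_iff.2 fun v₀ hv₀ ε hε => ?_, fun v hv =>
    (hZ.isAdaptedCurve hv).ito_mem_lpMeas hw hu (le_lastOr hv hub) ((lastOr_le hv).trans hb)⟩
  obtain ⟨M, hM⟩ := (isCompact_simplex (r + 1) u b).exists_bound_of_continuousOn hZ.cont
  obtain ⟨η, hη, hηε⟩ := exists_pos_bound_lt C T M (pow_pos hε 2)
  obtain ⟨δ, hδ, h⟩ := Metric.uniformContinuousOn_iff.1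
    ((isCompact_simplex (r + 1) u b).uniformContinuousOn_of_continuous hZ.cont) η hη
  refine ⟨min δ η, lt_min hδ hη, fun v hv hd => ?_⟩
  have hmem := sub_mem
    ((hZ.isAdaptedCurve hv).ito_mem hw hu (le_lastOr hv hub) ((lastOr_le hv).trans hb))
    ((hZ.isAdaptedCurve hv₀).ito_mem hw hu (le_lastOr hv₀ hub) ((lastOr_le hv₀).trans hb))
  have hL : lastOr r v b ⊔ lastOr r v₀ b - lastOr r v b ⊓ lastOr r v₀ b ≤ η := by
    rw [max_sub_min_eq_abs']
    exact (abs_lastOr_sub_le v v₀ b).trans (hd.le.trans (min_le_right _ _))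
  have hsq := hw.norm_sq_le (hu.trans (hub.trans hb)) hmem (ε := η) (M := M)
    (min_le_max (a := lastOr r v b) (b := lastOr r v₀ b)) fun s _ => by
      simp only [Prod.fst_sub, Pi.sub_apply]
      by_cases h1 : s ∈ Ico u (lastOr r v b) <;> by_cases h2 : s ∈ Ico u (lastOr r v₀ b)
      · left
        rw [indicator_of_mem h1, indicator_of_mem h2, ← dist_eq_norm]
        exact (h _ (snoc_mem_simplex hv (Ico_subset_Icc_self h1)) _
          (snoc_mem_simplex hv₀ (Ico_subset_Icc_self h2))
          ((dist_snoc_le v v₀ s).trans_lt (hd.trans_le (min_le_left _ _)))).le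
      · right
        rw [indicator_of_mem h1, indicator_of_notMem h2, sub_zero]
        exact ⟨⟨(min_le_right _ _).trans (not_lt.1 fun h3 => h2 ⟨h1.1, h3⟩),
          h1.2.trans_le (le_max_left _ _)⟩,
          hM _ (snoc_mem_simplex hv (Ico_subset_Icc_self h1))⟩
      · right
        rw [indicator_of_notMem h1, indicator_of_mem h2, zero_sub, norm_neg]
        exact ⟨⟨(min_le_left _ _).trans (not_lt.1 fun h3 => h1 ⟨h2.1, h3⟩),
          h2.2.trans_le (le_max_right _ _)⟩,
          hM _ (snoc_mem_simplex hv₀ (Ico_subset_Icc_self h2))⟩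
      · left
        rw [indicator_of_notMem h1, indicator_of_notMem h2, sub_zero, norm_zero]
        exact hη.le
  rw [dist_eq_norm]
  refine lt_of_pow_lt_pow_left₀ 2 hε.le (hsq.trans_lt (lt_of_le_of_lt ?_ hηε))
  gcongr

/-- Linear relations between kernels over different intervals persist, up to a constant factor in
the error, for the iterated integrals. -/
lemma norm_sum_iter_sub_le {W : Fin r → ℝ → Ω → ℝ} (hW : ∀ j, IsL2Integrator P 𝓕 T C (W j))
    {s : ℝ} (hs : 0 ≤ s) (hsb : s ≤ b) (hb : b ≤ T) {ι : Type*} {S : Finset ι} {u : ι → ℝ}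
    (hu : ∀ l ∈ S, u l ∈ Icc s b) {Z : ι → (Fin r → ℝ) → Lp ℝ 2 P}
    (hZ : ∀ l ∈ S, IsKernel P 𝓕 r (Z l) (u l) b) {Z₀ : (Fin r → ℝ) → Lp ℝ 2 P}
    (hZ₀ : IsKernel P 𝓕 r Z₀ s b) {ε : ℝ} (hε : 0 ≤ ε)
    (h : ∀ v ∈ simplex r s b,
      ‖∑ l ∈ S, (if u l ≤ lastOr r v b then Z l v else 0) - Z₀ v‖ ≤ ε) :
    ‖∑ l ∈ S, iter P 𝓕 T r W (Z l) (u l) b - iter P 𝓕 T r W Z₀ s b‖ ≤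
      Real.sqrt (C * T) ^ r * ε := by
  induction r generalizing ε with
  | zero =>
    have h1 := h Fin.elim0 ⟨fun i => i.elim0, fun i => i.elim0⟩
    -- With no variables `lastOr` is `b`, so every condition holds.
    have h2 : ∑ l ∈ S, (if u l ≤ lastOr 0 Fin.elim0 b then Z l Fin.elim0 else 0) =
        ∑ l ∈ S, Z l Fin.elim0 := Finset.sum_congr rfl fun l hl => if_pos (hu l hl).2
    rw [h2] at h1
    simpa [iter] using h1
  | succ r ih =>
    -- One factor `√(C T)` pays for the innermost integration, done here for fixed `v`; the
    -- induction hypothesis pays for the others.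
    rw [pow_succ, mul_assoc]
    refine ih (fun j => hW j.castSucc)
      (fun l hl => (hZ l hl).ito (hW _) (hs.trans (hu l hl).1) (hu l hl).2 hb)
      (hZ₀.ito (hW _) hs hsb hb) (by positivity) fun v hv => ?_
    set L := lastOr r v b with hL
    have hLT : L ≤ T := (lastOr_le hv).trans hb
    let F : ι → ℝ → Lp ℝ 2 P := fun l =>
      if u l ≤ L then (Ico (u l) L).indicator fun x => Z l (Fin.snoc v x) else 0
    have hF : ∀ l ∈ S, (F l, if u l ≤ L then ito P 𝓕 T (W (Fin.last r)) (u l) L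
        (fun x => Z l (Fin.snoc v x)) else 0) ∈ itoGraph P 𝓕 T (W (Fin.last r)) := fun l hl => by
      by_cases hul : u l ≤ L
      · simp only [F, if_pos hul]
        exact ((hZ l hl).isAdaptedCurve (mem_simplex_of_le_lastOr hv hul)).ito_mem (hW _)
          (hs.trans (hu l hl).1) hul hLT
      · simp only [F, if_neg hul]
        exact zero_mem _
    have hmem := sub_mem (Submodule.sum_mem _ hF)
      ((hZ₀.isAdaptedCurve hv).ito_mem (hW _) hs (le_lastOr hv hsb) hLT)
    have hle := (hW (Fin.last r)).norm_le (hs.trans (hsb.trans hb)) hmem hε fun x _ => by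
      rw [Prod.fst_sub, Prod.fst_sum, Pi.sub_apply, Finset.sum_apply]
      simp only
      by_cases hx : x ∈ Ico s L
      · have h1 := h _ (snoc_mem_simplex hv (Ico_subset_Icc_self hx))
        rw [lastOr_snoc] at h1
        rw [indicator_of_mem hx]
        convert h1 using 3
        refine Finset.sum_congr rfl fun l _ => ?_
        -- For `x < L`, lying in the integration interval `[u l, L)` is exactly the condition
        -- attached to the tuple with last coordinate `x`.
        by_cases hul : u l ≤ x
        · simp only [F, if_pos hul, if_pos (hul.trans hx.2.le)]
          rw [indicator_of_mem (show x ∈ Ico (u l) L from ⟨hul, hx.2⟩)]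
        · rw [if_neg hul]
          by_cases hul' : u l ≤ L
          · simp only [F, if_pos hul']
            exact indicator_of_notMem (fun h2 => hul h2.1) _
          · simp only [F, if_neg hul', Pi.zero_apply]
      · rw [indicator_of_notMem hx, Finset.sum_eq_zero, sub_zero, norm_zero]
        · exact hε
        · intro l hl
          by_cases hul' : u l ≤ L
          · simp only [F, if_pos hul']
            exact indicator_of_notMem (fun h2 => hx ⟨(hu l hl).1.trans h2.1, h2.2⟩) _
          · simp only [F, if_neg hul', Pi.zero_apply]
    simpa only [Prod.snd_sub, Prod.snd_sum] using hle

/-- A factor from the past can be taken out of the iterated integral. -/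
lemma IsKernel.iter_ae_eq_mul {W : Fin r → ℝ → Ω → ℝ}
    (hW : ∀ j, IsL2Integrator P 𝓕 T C (W j)) {Z Z' : (Fin r → ℝ) → Lp ℝ 2 P}
    (hZ : IsKernel P 𝓕 r Z u b) (hZ' : IsKernel P 𝓕 r Z' u b) (hu : 0 ≤ u) (hub : u ≤ b)
    (hb : b ≤ T) {η : Ω → ℝ} (h : ∀ v ∈ simplex r u b, Z' v =ᵐ[P] fun ω => η ω * Z v ω) :
    iter P 𝓕 T r W Z' u b =ᵐ[P] fun ω => η ω * iter P 𝓕 T r W Z u b ω := by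
  induction r with
  | zero => exact h _ ⟨fun i => i.elim0, fun i => i.elim0⟩
  | succ r ih =>
    exact ih (fun j => hW j.castSucc) (hZ.ito (hW _) hu hub hb) (hZ'.ito (hW _) hu hub hb)
      fun v hv => (hZ.isAdaptedCurve hv).ito_ae_eq_mul (hZ'.isAdaptedCurve hv) (hW _) hu
        (le_lastOr hv hub) ((lastOr_le hv).trans hb)
        fun x hx => h _ (snoc_mem_simplex hv hx)

end Iter

/-! ### Replacing the order of integration -/

section Order

variable {P : Measure Ω} {𝓕 : Filtration ℝ mΩ} {T : ℝ} {C : ℝ≥0} {r : ℕ}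

lemma increment_smul {w : ℝ → Ω → ℝ} (hw : IsL2Integrator P 𝓕 T C w) {a b : ℝ} (ha : 0 ≤ a)
    (hab : a ≤ b) (hb : b ≤ T) {c : Lp ℝ 2 P} (hc : c ∈ lpMeas ℝ ℝ (𝓕 a) 2 P) (k : ℝ) :
    increment P w a b (k • c) = k • increment P w a b c := by
  refine Lp.ext ?_
  filter_upwards [coeFn_increment hw ha hab hb hc,
    coeFn_increment hw ha hab hb (Submodule.smul_mem _ k hc), Lp.coeFn_smul k c,
    Lp.coeFn_smul k (increment P w a b c)] with ω h1 h2 h3 h4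
  rw [h2, h4, h3, Pi.smul_apply, Pi.smul_apply, h1, smul_eq_mul, smul_eq_mul, mul_assoc]

lemma IsAdaptedCurve.isKernel_smul {u b : ℝ} {B : ℝ → Lp ℝ 2 P} (hB : IsAdaptedCurve P 𝓕 u b B)
    {Ψ : (Fin (r + 1) → ℝ) → ℝ} (hΨ : ContinuousOn Ψ (simplex (r + 1) u b)) :
    IsKernel P 𝓕 (r + 1) (fun v => Ψ v • B (v (Fin.last r))) u b :=
  ⟨hΨ.smul (hB.cont.comp (continuous_apply _).continuousOn fun _ hv => hv.2 _),
    fun _ hv => Submodule.smul_mem _ _ (hB.adapted _ (hv.2 _))⟩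

lemma isKernel_smul_const {u b : ℝ} {c : Lp ℝ 2 P} (hc : c ∈ lpMeas ℝ ℝ (𝓕 u) 2 P) (hub : u ≤ b)
    {Ψ : (Fin r → ℝ) → ℝ} (hΨ : ContinuousOn Ψ (simplex r u b)) :
    IsKernel P 𝓕 r (fun v => Ψ v • c) u b :=
  ⟨hΨ.smul continuousOn_const, fun _ hv =>
    Submodule.smul_mem _ _ (lpMeas_mono (le_lastOr hv hub) hc)⟩

lemma continuousOn_comp_snoc {s x u b : ℝ} {Ψ : (Fin (r + 1) → ℝ) → ℝ}
    (hΨ : ContinuousOn Ψ (simplex (r + 1) s b)) (hsx : s ≤ x) (hxu : x ≤ u) (hub : u ≤ b) :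
    ContinuousOn (fun v : Fin r → ℝ => Ψ (Fin.snoc v x)) (simplex r u b) := by
  refine hΨ.comp (Continuous.continuousOn ?_) fun v hv =>
    snoc_mem_simplex (simplex_mono (hsx.trans hxu) le_rfl hv) ⟨hsx, hxu.trans (le_lastOr hv hub)⟩
  refine continuous_pi fun j => ?_
  induction j using Fin.lastCases with
  | last => simpa using continuous_const
  | cast j => simpa using continuous_apply j

/-- The sums of the order-replaced integral converge to the iterated integral. -/
lemma tendsto_sum_iter {W : Fin (r + 1) → ℝ → Ω → ℝ} (hW : ∀ j, IsL2Integrator P 𝓕 T C (W j))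
    {s : ℝ} (hs : 0 ≤ s) (hsT : s ≤ T) {B : ℝ → Lp ℝ 2 P} (hB : IsAdaptedCurve P 𝓕 s T B)
    {Ψ : (Fin (r + 1) → ℝ) → ℝ} (hΨ : ContinuousOn Ψ (simplex (r + 1) s T)) :
    Tendsto (fun π : Partition s T => ∑ l ∈ Finset.range π.N, iter P 𝓕 T r (Fin.init W)
      (fun v => Ψ (Fin.snoc v (π.pt l)) •
        increment P (W (Fin.last r)) (π.pt l) (π.pt (l + 1)) (B (π.pt l))) (π.pt (l + 1)) T)
      (meshFilter s T)
      (𝓝 (iter P 𝓕 T (r + 1) W (fun v => Ψ v • B (v (Fin.last r))) s T)) := by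
  have hZ := hB.isKernel_smul hΨ
  rw [Metric.tendsto_nhds]
  intro ε hε
  obtain ⟨ε', hε', hεε'⟩ : ∃ ε' > 0, Real.sqrt (C * T) ^ r * ε' < ε := by
    refine ⟨ε / (Real.sqrt (C * T) ^ r + 1), by positivity, ?_⟩
    rw [mul_div_assoc', div_lt_iff₀ (by positivity)]
    nlinarith
  obtain ⟨M, hM⟩ := (isCompact_simplex (r + 1) s T).exists_bound_of_continuousOn hZ.cont
  obtain ⟨η, hη, hηε⟩ := exists_pos_bound_lt C T M (pow_pos hε' 2)
  obtain ⟨δ, hδ, h⟩ := Metric.uniformContinuousOn_iff.1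
    ((isCompact_simplex (r + 1) s T).uniformContinuousOn_of_continuous hZ.cont) η hη
  filter_upwards [eventually_mesh_lt (lt_min hδ hη)] with π hπ
  have hBm : ∀ l < π.N, B (π.pt l) ∈ lpMeas ℝ ℝ (𝓕 (π.pt l)) 2 P := fun l hl =>
    hB.adapted _ (π.pt_mem_Icc hl.le)
  have h0 : ∀ l < π.N, 0 ≤ π.pt l := fun l hl => hs.trans (π.left_le_pt hl.le)
  rw [dist_eq_norm, iter]
  refine lt_of_le_of_lt (norm_sum_iter_sub_le (fun j => hW j.castSucc) hs hsT le_rfl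
    (fun l hl => π.pt_mem_Icc (Finset.mem_range.1 hl)) (fun l hl => ?_)
    (hZ.ito (hW _) hs hsT le_rfl) hε'.le fun v hv => ?_) hεε'
  · rw [Finset.mem_range] at hl
    exact isKernel_smul_const (increment_mem (hW _) (h0 l hl) (π.pt_lt l hl).le
      (π.pt_le_right hl) (hBm l hl)) (π.pt_le_right hl)
      (continuousOn_comp_snoc hΨ (π.left_le_pt hl.le) (π.pt_lt l hl).le (π.pt_le_right hl))
  set L := lastOr r v T with hL
  -- Only the cells that end by `L` are kept, since the `l`-th outer integral runs over `[τ_{l+1},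
  -- T]`.
  let c : ℕ → Lp ℝ 2 P := fun l =>
    if π.pt (l + 1) ≤ L then Ψ (Fin.snoc v (π.pt l)) • B (π.pt l) else 0
  have hc : ∀ l < π.N, c l ∈ lpMeas ℝ ℝ (𝓕 (π.pt l)) 2 P := fun l hl => by
    by_cases hlL : π.pt (l + 1) ≤ L
    · simp only [c, if_pos hlL]
      exact Submodule.smul_mem _ _ (hBm l hl)
    · simp only [c, if_neg hlL]
      exact zero_mem _
  have hsum : ∑ l ∈ Finset.range π.N, (if π.pt (l + 1) ≤ L then Ψ (Fin.snoc v (π.pt l)) •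
      increment P (W (Fin.last r)) (π.pt l) (π.pt (l + 1)) (B (π.pt l)) else 0) =
      stepSum P (W (Fin.last r)) π c := by
    refine Finset.sum_congr rfl fun l hl => ?_
    rw [Finset.mem_range] at hl
    have hinc := fun k => increment_smul (hW (Fin.last r)) (h0 l hl) (π.pt_lt l hl).le
      (π.pt_le_right hl) (hBm l hl) k
    by_cases hlL : π.pt (l + 1) ≤ L
    · simp only [c, if_pos hlL, hinc]
    · simp only [c, if_neg hlL]
      simpa using (hinc 0).symm
  have hmem := sub_mem (elementary_le_itoGraph (step_mem_elementary (w := W (Fin.last r)) hs le_rfl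
    π hc)) ((hZ.isAdaptedCurve hv).ito_mem (hW (Fin.last r)) hs (le_lastOr hv hsT) (lastOr_le hv))
  rw [hsum]
  -- The kept cells give an error of at most `η` by uniform continuity. The cell cut by `L`, if any,
  -- is dropped; its part below `L` lies in `[L - η, L)` because the mesh is below `η`.
  have hsq := (hW (Fin.last r)).norm_sq_le (hs.trans hsT) hmem (ε := η) (M := M)
    (show L - η ≤ L by linarith) fun x _ => by
      simp only [Prod.fst_sub, Pi.sub_apply]
      by_cases hx : x ∈ Ico s L
      · obtain ⟨j, hj, hxj⟩ := π.exists_mem_Ico ⟨hx.1, hx.2.trans_le (lastOr_le hv)⟩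
        have hstep := π.sub_le_mesh hj
        rw [indicator_of_mem hx, stepCurve, π.sum_indicator_of_mem _ hj hxj]
        by_cases hjL : π.pt (j + 1) ≤ L
        · left
          have hd := h _ (snoc_mem_simplex hv (x := π.pt j)
            ⟨π.left_le_pt hj.le, (π.pt_lt j hj).le.trans hjL⟩) _
            (snoc_mem_simplex hv (Ico_subset_Icc_self hx))
            ((dist_snoc_right_le v (π.pt j) x).trans_lt (by
              rw [abs_sub_comm, abs_of_nonneg (sub_nonneg.2 hxj.1)]
              linarith [hxj.2, min_le_left δ η]))
          simp only [c, if_pos hjL]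
          rw [dist_eq_norm] at hd
          simpa only [Fin.snoc_last] using hd.le
        · right
          simp only [c, if_neg hjL, zero_sub, norm_neg]
          refine ⟨⟨?_, hx.2⟩, hM _ (snoc_mem_simplex hv (Ico_subset_Icc_self hx))⟩
          linarith [hxj.1, not_le.1 hjL, min_le_right δ η]
      · left
        rw [indicator_of_notMem hx, sub_zero, stepCurve, Finset.sum_eq_zero, norm_zero]
        · exact hη.le
        · intro l hl
          rw [Finset.mem_range] at hl
          by_cases hxl : x ∈ Ico (π.pt l) (π.pt (l + 1))
          · rw [indicator_of_mem hxl]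
            refine if_neg fun hlL => hx ⟨(π.left_le_pt hl.le).trans hxl.1, hxl.2.trans_le hlL⟩
          · exact indicator_of_notMem hxl _
  refine (lt_of_pow_lt_pow_left₀ 2 hε'.le (hsq.trans_lt ?_)).le
  rwa [show L - (L - η) = η by ring]

/-- As an equivalence this gives both existence and uniqueness of the limit; uniqueness uses that
partitions of arbitrarily small mesh exist. -/
lemma isMeanSquareLimit_iff_ae_eq {s : ℝ} (hsT : s ≤ T) {S : Partition s T → Ω → ℝ}
    {x : Partition s T → Lp ℝ 2 P} {x₀ : Lp ℝ 2 P} (hx : Tendsto x (meshFilter s T) (𝓝 x₀))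
    (hS : ∀ π, S π =ᵐ[P] x π) {X : Ω → ℝ} : IsMeanSquareLimit P S X ↔ X =ᵐ[P] x₀ := by
  have hne := meshFilter_neBot hsT
  rw [isMeanSquareLimit_iff]
  have hnorm : ∀ y : Lp ℝ 2 P, X =ᵐ[P] y → ∀ π,
      eLpNorm (fun ω => S π ω - X ω) 2 P = ‖x π - y‖ₑ := fun y hy π => by
    refine eLpNorm_eq_enorm ?_
    filter_upwards [hS π, hy, Lp.coeFn_sub (x π) y] with ω h1 h2 h3
    rw [h3, Pi.sub_apply, h1, h2]
  constructor
  · rintro ⟨hX, h⟩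
    have hXy := hX.coeFn_toLp.symm
    simp only [hnorm _ hXy] at h
    rwa [tendsto_nhds_unique (tendsto_iff_enorm_sub.2 h) hx] at hXy
  · intro hX
    refine ⟨memLp_of_ae_eq hX, ?_⟩
    simp only [hnorm _ hX]
    exact tendsto_iff_enorm_sub.1 hx

variable [IsProbabilityMeasure P]

/-- The constant `1` as an element of `L²`. -/
def oneL2 (P : Measure Ω) [IsProbabilityMeasure P] : Lp ℝ 2 P := (memLp_const (1 : ℝ)).toLp

lemma coeFn_oneL2 : oneL2 P =ᵐ[P] fun _ => (1 : ℝ) := MemLp.coeFn_toLp _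

lemma oneL2_mem (s : ℝ) : oneL2 P ∈ lpMeas ℝ ℝ (𝓕 s) 2 P := by
  rw [mem_lpMeas_iff_aestronglyMeasurable]
  exact AEStronglyMeasurable.congr aestronglyMeasurable_const coeFn_oneL2.symm

lemma isAdaptedCurve_oneL2 (a b : ℝ) : IsAdaptedCurve P 𝓕 a b fun _ => oneL2 P :=
  ⟨continuousOn_const, fun s _ => oneL2_mem s⟩

/-- Serves both definitions: `ξ = 1` for the nonrandom kernels, and a `Y` independent of its first
argument for the outer sum with `ξ`. Each product in the sum agrees almost everywhere with an
iterated integral, which also shows that it is square integrable. -/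
lemma isMeanSquareLimit_sum_iff {W : Fin (r + 1) → ℝ → Ω → ℝ}
    (hW : ∀ j, IsL2Integrator P 𝓕 T C (W j)) {s : ℝ} (hs : 0 ≤ s) (hsT : s ≤ T)
    {B : ℝ → Lp ℝ 2 P} (hB : IsAdaptedCurve P 𝓕 s T B) {ξ : ℝ → Ω → ℝ}
    (hξ : ∀ x ∈ Icc s T, ξ x =ᵐ[P] B x) {Ψ : (Fin (r + 1) → ℝ) → ℝ}
    (hΨ : ContinuousOn Ψ (simplex (r + 1) s T)) {Y : ℝ → ℝ → Ω → ℝ}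
    (hY : ∀ x u, s ≤ x → x ≤ u → u ≤ T → Y x u =ᵐ[P]
      iter P 𝓕 T r (Fin.init W) (fun v => Ψ (Fin.snoc v x) • oneL2 P) u T) {X : Ω → ℝ} :
    IsMeanSquareLimit P (fun (π : Partition s T) ω => ∑ l ∈ Finset.range π.N,
      ξ (π.pt l) ω * (W (Fin.last r) (π.pt (l + 1)) ω - W (Fin.last r) (π.pt l) ω) *
        Y (π.pt l) (π.pt (l + 1)) ω) X ↔
    X =ᵐ[P] iter P 𝓕 T (r + 1) W (fun v => Ψ v • B (v (Fin.last r))) s T := by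
  refine isMeanSquareLimit_iff_ae_eq hsT (tendsto_sum_iter hW hs hsT hB hΨ) fun π => ?_
  have hterm : ∀ l ∈ Finset.range π.N, (fun ω => ξ (π.pt l) ω *
      (W (Fin.last r) (π.pt (l + 1)) ω - W (Fin.last r) (π.pt l) ω) *
        Y (π.pt l) (π.pt (l + 1)) ω) =ᵐ[P] iter P 𝓕 T r (Fin.init W)
      (fun v => Ψ (Fin.snoc v (π.pt l)) •
        increment P (W (Fin.last r)) (π.pt l) (π.pt (l + 1)) (B (π.pt l))) (π.pt (l + 1)) T := by
    intro l hl
    rw [Finset.mem_range] at hl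
    have hlt := (π.pt_lt l hl).le
    have h0 := hs.trans (π.left_le_pt hl.le)
    have hle := π.pt_le_right hl
    have hBl := hB.adapted _ (π.pt_mem_Icc hl.le)
    have hcont := continuousOn_comp_snoc hΨ (π.left_le_pt hl.le) hlt hle
    have hprod := IsKernel.iter_ae_eq_mul (W := Fin.init W) (fun j => hW j.castSucc)
      (isKernel_smul_const (oneL2_mem (P := P) (𝓕 := 𝓕) (π.pt (l + 1))) hle hcont)
      (isKernel_smul_const (increment_mem (hW (Fin.last r)) h0 hlt hle hBl) hle hcont)
      (h0.trans hlt) hle le_rfl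
      (η := fun ω => ξ (π.pt l) ω *
        (W (Fin.last r) (π.pt (l + 1)) ω - W (Fin.last r) (π.pt l) ω)) fun v _ => by
      filter_upwards [Lp.coeFn_smul (Ψ (Fin.snoc v (π.pt l))) (oneL2 P),
        Lp.coeFn_smul (Ψ (Fin.snoc v (π.pt l)))
          (increment P (W (Fin.last r)) (π.pt l) (π.pt (l + 1)) (B (π.pt l))),
        coeFn_increment (hW (Fin.last r)) h0 hlt hle hBl, coeFn_oneL2 (P := P),
        hξ _ (π.pt_mem_Icc hl.le)] with ω h1 h2 h3 h4 h5
      rw [h1, h2, Pi.smul_apply, Pi.smul_apply, h3, h4, h5, smul_eq_mul, smul_eq_mul]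
      ring
    filter_upwards [hprod, hY _ _ (π.left_le_pt hl.le) hlt hle] with ω h1 h2
    rw [h1, h2]
  filter_upwards [(Finset.eventually_all _).2 hterm, Lp.coeFn_finsetSum (Finset.range π.N)
    fun l => iter P 𝓕 T r (Fin.init W) (fun v => Ψ (Fin.snoc v (π.pt l)) •
        increment P (W (Fin.last r)) (π.pt l) (π.pt (l + 1)) (B (π.pt l))) (π.pt (l + 1)) T]
    with ω h1 h2
  rw [h2, Finset.sum_apply]
  exact Finset.sum_congr rfl h1

variable {m : ℕ} {w : Fin (m + 1) → ℝ → Ω → ℝ}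

/-- In the induction, one direction turns arbitrary versions of the inner integrals into `iter`, and
the other supplies versions when existence is needed. -/
lemma isOrderReplaced_iff (hw : ∀ j, IsL2Integrator P 𝓕 T C (w j)) {n : ℕ}
    {i : Fin (n + 1) → Fin (m + 1)} {Φ : (Fin (n + 1) → ℝ) → ℝ} {s : ℝ} (hs : 0 ≤ s)
    (hsT : s ≤ T) (hΦ : ContinuousOn Φ (simplex (n + 1) s T)) {X : Ω → ℝ} :
    IsOrderReplaced P 𝓕 w T n i Φ s X ↔
      X =ᵐ[P] iter P 𝓕 T (n + 1) (fun j => w (i j)) (fun v => Φ v • oneL2 P) s T := by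
  induction n generalizing s X with
  | zero =>
    have hA := ((isAdaptedCurve_oneL2 (P := P) (𝓕 := 𝓕) s T).isKernel_smul hΦ).isAdaptedCurve
      (v := Fin.elim0) ⟨fun i => i.elim0, fun i => i.elim0⟩
    have hsnoc : ∀ x : ℝ, (Fin.snoc (α := fun _ => ℝ) (Fin.elim0 : Fin 0 → ℝ) x) =
        fun _ => x := fun x => by
      ext j
      obtain rfl : j = Fin.last 0 := Fin.fin_one_eq_zero j
      exact Fin.snoc_last ..
    have hξ : ∀ x ∈ Icc s T, (fun _ : Ω => Φ fun _ => x) =ᵐ[P]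
        (Φ (Fin.snoc Fin.elim0 x) • oneL2 P : Lp ℝ 2 P) := fun x _ => by
      filter_upwards [Lp.coeFn_smul (Φ (Fin.snoc Fin.elim0 x)) (oneL2 P),
        coeFn_oneL2 (P := P)] with ω h1 h2
      rw [h1, Pi.smul_apply, h2, hsnoc, smul_eq_mul, mul_one]
    refine ⟨fun h => h.ae_eq_ito hA (hw _) hs hsT le_rfl hξ, fun h =>
      hA.isItoIntegral (hw _) hs hsT le_rfl (memM2_of_ae_eq hA.cont ?_ (fun _ _ =>
        measurable_const) hξ) hξ h⟩
    have hc : ContinuousOn (fun x : ℝ => Φ fun _ => x) (Icc s T) :=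
      hΦ.comp (by fun_prop) fun x hx => ⟨fun _ _ _ => le_rfl, fun _ => hx⟩
    exact (continuousOn_iff_continuous_domRestrict.1 hc).measurable.comp measurable_fst
  | succ n ih =>
    have hΦ' : ∀ x u, s ≤ x → x ≤ u → u ≤ T →
        ContinuousOn (fun v : Fin (n + 1) → ℝ => Φ (Fin.snoc v x)) (simplex (n + 1) u T) :=
      fun x u h1 h2 h3 => continuousOn_comp_snoc hΦ h1 h2 h3
    have key : ∀ Y : ℝ → ℝ → Ω → ℝ, (∀ x u, s ≤ x → x ≤ u → u ≤ T → Y x u =ᵐ[P]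
        iter P 𝓕 T (n + 1) (fun j => w (Fin.init i j)) (fun v => Φ (Fin.snoc v x) • oneL2 P)
          u T) → ∀ X, IsMeanSquareLimit P (fun (π : Partition s T) ω =>
        ∑ l ∈ Finset.range π.N, (w (i (Fin.last (n + 1))) (π.pt (l + 1)) ω -
          w (i (Fin.last (n + 1))) (π.pt l) ω) * Y (π.pt l) (π.pt (l + 1)) ω) X ↔
        X =ᵐ[P] iter P 𝓕 T (n + 2) (fun j => w (i j)) (fun v => Φ v • oneL2 P) s T := by
      intro Y hY X
      have := isMeanSquareLimit_sum_iff (W := fun j => w (i j)) (fun j => hw _) hs hsT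
        (isAdaptedCurve_oneL2 s T) (ξ := fun _ _ => 1) (fun _ _ => coeFn_oneL2.symm) hΦ hY (X := X)
      simpa only [one_mul] using this
    rw [IsOrderReplaced]
    constructor
    · rintro ⟨Y, hY, hX⟩
      exact (key Y (fun x u h1 h2 h3 =>
        (ih ((hs.trans h1).trans h2) h3 (hΦ' x u h1 h2 h3)).1 (hY x u h1 h2 h3)) X).1 hX
    · intro hX
      refine ⟨fun x u => iter P 𝓕 T (n + 1) (fun j => w (Fin.init i j))
        (fun v => Φ (Fin.snoc v x) • oneL2 P) u T, fun x u h1 h2 h3 =>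
        (ih ((hs.trans h1).trans h2) h3 (hΦ' x u h1 h2 h3)).2 (EventuallyEq.refl _ _), ?_⟩
      exact (key _ (fun x u _ _ _ => EventuallyEq.refl _ _) X).2 hX

/-- The kernel `Φ ∘ Fin.init` ignores its last variable, so freezing that variable at `τ_l` gives
back `Φ`; the last variable enters only through `B`. -/
lemma isOrderReplacedWith_iff (hw : ∀ j, IsL2Integrator P 𝓕 T C (w j)) {n : ℕ}
    {i : Fin (n + 2) → Fin (m + 1)} {Φ : (Fin (n + 1) → ℝ) → ℝ} {t : ℝ} (ht : 0 ≤ t)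
    (htT : t ≤ T) (hΦ : ContinuousOn Φ (simplex (n + 1) t T)) {B : ℝ → Lp ℝ 2 P}
    (hB : IsAdaptedCurve P 𝓕 t T B) {ξ : ℝ → Ω → ℝ} (hξ : ∀ x ∈ Icc t T, ξ x =ᵐ[P] B x)
    {X : Ω → ℝ} :
    IsOrderReplacedWith P 𝓕 w ξ t T n i Φ X ↔
      X =ᵐ[P] iter P 𝓕 T (n + 2) (fun j => w (i j))
        (fun v => Φ (Fin.init v) • B (v (Fin.last (n + 1)))) t T := by
  have hΦ' : ∀ u, t ≤ u → ContinuousOn Φ (simplex (n + 1) u T) := fun u hu =>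
    hΦ.mono (simplex_mono hu le_rfl)
  have key : ∀ Y : ℝ → Ω → ℝ, (∀ u ∈ Icc t T, Y u =ᵐ[P] iter P 𝓕 T (n + 1)
      (fun j => w (Fin.init i j)) (fun v => Φ v • oneL2 P) u T) → ∀ X,
      (IsMeanSquareLimit P (fun (π : Partition t T) ω => ∑ l ∈ Finset.range π.N, ξ (π.pt l) ω *
        (w (i (Fin.last (n + 1))) (π.pt (l + 1)) ω - w (i (Fin.last (n + 1))) (π.pt l) ω) *
          Y (π.pt (l + 1)) ω) X ↔
      X =ᵐ[P] iter P 𝓕 T (n + 2) (fun j => w (i j))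
        (fun v => Φ (Fin.init v) • B (v (Fin.last (n + 1)))) t T) := by
    intro Y hY X
    exact isMeanSquareLimit_sum_iff (W := fun j => w (i j)) (fun j => hw _) ht htT hB hξ
      (Ψ := fun v => Φ (Fin.init v))
      (hΦ.comp continuous_init.continuousOn fun v hv => init_mem_simplex hv)
      (Y := fun _ u => Y u) (fun x u h1 h2 h3 => by
        simp only [Fin.init_snoc]
        exact hY u ⟨h1.trans h2, h3⟩)
  constructor
  · rintro ⟨Y, hY, hX⟩
    exact (key Y (fun u hu => (isOrderReplaced_iff hw (ht.trans hu.1) hu.2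
      (hΦ' u hu.1)).1 (hY u hu)) X).1 hX
  · intro hX
    exact ⟨fun u => iter P 𝓕 T (n + 1) (fun j => w (Fin.init i j)) (fun v => Φ v • oneL2 P) u T,
      fun u hu => (isOrderReplaced_iff hw (ht.trans hu.1) hu.2 (hΦ' u hu.1)).2
        (EventuallyEq.refl _ _), (key _ (fun u _ => EventuallyEq.refl _ _) X).2 hX⟩

end Order

/-! ### The iterated Ito integral -/

section Iterated

variable {P : Measure Ω} {𝓕 : Filtration ℝ mΩ} {T : ℝ} {C : ℝ≥0} {r : ℕ} {u b : ℝ}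

/-- The innermost integrations are carried out one by one through `IsKernel.ito`, until a kernel of
the outermost variable alone is left. -/
lemma IsKernel.isAdaptedCurve_iter {W : Fin r → ℝ → Ω → ℝ}
    (hW : ∀ j, IsL2Integrator P 𝓕 T C (W j)) {Z : (Fin (r + 1) → ℝ) → Lp ℝ 2 P}
    (hZ : IsKernel P 𝓕 (r + 1) Z u b) (hu : 0 ≤ u) (hub : u ≤ b) (hb : b ≤ T) :
    IsAdaptedCurve P 𝓕 u b fun t => iter P 𝓕 T r W (fun v => Z (Fin.cons t v)) u t := by
  induction r with
  | zero =>
    have h := hZ.isAdaptedCurve (v := Fin.elim0) ⟨fun i => i.elim0, fun i => i.elim0⟩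
    have heq : (fun t => iter P 𝓕 T 0 W (fun v => Z (Fin.cons t v)) u t) =
        fun x => Z (Fin.snoc Fin.elim0 x) := by
      ext1 x
      simp only [iter]
      congr 1
      ext1 j
      obtain rfl : j = Fin.last 0 := Fin.fin_one_eq_zero j
      rw [Fin.snoc_last]
      rfl
    rw [heq]
    exact h
  | succ r ih =>
    have h := ih (W := Fin.init W) (fun j => hW j.castSucc) (hZ.ito (hW (Fin.last r)) hu hub hb)
    convert h using 2 with t
    rw [iter]
    congr 1
    ext1 v
    rw [show lastOr (r + 1) (Fin.cons (α := fun _ => ℝ) t v) b = lastOr r v t by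
      cases r <;> rfl]
    congr 1
    ext1 x
    rw [Fin.cons_snoc_eq_snoc_cons]

lemma init_cons_eq (t : ℝ) (v : Fin (r + 1) → ℝ) :
    (Fin.init (Fin.cons (α := fun _ => ℝ) t v : Fin (r + 2) → ℝ) : Fin (r + 1) → ℝ) =
      Fin.cons t (Fin.init v) := by
  ext j
  induction j using Fin.cases with
  | zero => rfl
  | succ j => rfl

/-- The outermost integral is peeled off by `iter_succ`, and the induction identifies the inner
values with a mean-square continuous adapted curve. -/
lemma isIteratedIto_iff {m : ℕ} {w : Fin (m + 1) → ℝ → Ω → ℝ}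
    (hw : ∀ j, IsL2Integrator P 𝓕 T C (w j)) {n : ℕ}
    {i : Fin (n + 1) → Fin (m + 1)} {Φ : (Fin n → ℝ) → ℝ} {t s : ℝ} (ht : 0 ≤ t) (hts : t ≤ s)
    (hsT : s ≤ T) (hΦ : ContinuousOn Φ (simplex n t s)) {ξ : ℝ → Ω → ℝ}
    (hM : MemM2 P 𝓕 t s ξ) {B : ℝ → Lp ℝ 2 P} (hB : IsAdaptedCurve P 𝓕 t s B)
    (hξ : ∀ x ∈ Icc t s, ξ x =ᵐ[P] B x) {X : Ω → ℝ} :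
    IsIteratedIto P 𝓕 w ξ t n i Φ s X ↔
      X =ᵐ[P] iter P 𝓕 T (n + 1) (fun j => w (i j))
        (fun v => Φ (Fin.init v) • B (v (Fin.last n))) t s := by
  have hZ := hB.isKernel_smul (Ψ := fun v => Φ (Fin.init v))
    (hΦ.comp continuous_init.continuousOn fun v hv => init_mem_simplex hv)
  induction n generalizing s X with
  | zero =>
    have hA := hZ.isAdaptedCurve (v := Fin.elim0) ⟨fun i => i.elim0, fun i => i.elim0⟩
    have hξ' : ∀ x ∈ Icc t s, (fun ω => Φ Fin.elim0 * ξ x ω) =ᵐ[P]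
        (Φ (Fin.init (Fin.snoc (α := fun _ => ℝ) (Fin.elim0 : Fin 0 → ℝ) x)) •
          B (Fin.snoc (α := fun _ => ℝ) (Fin.elim0 : Fin 0 → ℝ) x (Fin.last 0)) :
          Lp ℝ 2 P) := fun x hx => by
      rw [Fin.init_snoc, Fin.snoc_last]
      filter_upwards [Lp.coeFn_smul (Φ Fin.elim0) (B x), hξ x hx] with ω h1 h2
      rw [h1, Pi.smul_apply, h2, smul_eq_mul]
    exact ⟨fun h => h.ae_eq_ito hA (hw _) ht hts hsT hξ', fun h =>
      hA.isItoIntegral (hw _) ht hts hsT (memM2_of_ae_eq hA.cont (hM.measurable.const_mul _)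
        (fun x hx => Measurable.const_mul (hM.adapted x hx) _) hξ') hξ' h⟩
  | succ n ih =>
    have hA := hZ.isAdaptedCurve_iter (W := Fin.tail fun j => w (i j)) (fun j => hw _) ht hts hsT
    have hinner : ∀ x ∈ Icc t s, ∀ Y : Ω → ℝ,
        IsIteratedIto P 𝓕 w ξ t n (Fin.tail i) (fun v => Φ (Fin.cons x v)) x Y ↔
        Y =ᵐ[P] iter P 𝓕 T (n + 1) (Fin.tail fun j => w (i j))
          (fun v => Φ (Fin.init (Fin.cons (α := fun _ => ℝ) x v)) •
            B (Fin.cons (α := fun _ => ℝ) x v (Fin.last (n + 1)))) t x := by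
      intro x hx Y
      have hΦx : ContinuousOn (fun v => Φ (Fin.cons x v)) (simplex n t x) :=
        hΦ.comp (continuous_cons x).continuousOn fun v hv => cons_mem_simplex hx hv
      have hBx := hB.mono le_rfl hx.2
      have hMx : MemM2 P 𝓕 t x ξ := by
        refine memM2_of_ae_eq hBx.cont ?_ (fun y hy => hM.adapted y ⟨hy.1, hy.2.trans hx.2⟩)
          fun y hy => hξ y ⟨hy.1, hy.2.trans hx.2⟩
        have hincl : Measurable fun y : Icc t x =>
            (⟨y, y.2.1, y.2.2.trans hx.2⟩ : Icc t s) := measurable_subtype_coe.subtype_mk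
        exact hM.measurable.comp
          ((hincl.comp measurable_fst).prodMk measurable_snd)
      refine (ih hx.1 (hx.2.trans hsT) hΦx hMx hBx (fun y hy => hξ y ⟨hy.1, hy.2.trans hx.2⟩)
        (hBx.isKernel_smul (hΦx.comp continuous_init.continuousOn fun v hv =>
          init_mem_simplex hv))).trans ?_
      simp only [init_cons_eq]
      rfl
    rw [iter_succ, IsIteratedIto]
    constructor
    · rintro ⟨Y, hY, hX⟩
      exact hX.ae_eq_ito hA (hw _) ht hts hsT fun x hx => (hinner x hx _).1 (hY x hx)
    · intro hX
      -- Versions chosen separately for each time need not be jointly measurable; this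
      -- representative is.
      obtain ⟨Y, hYM, hY⟩ := hA.exists_memM2 hts
      exact ⟨Y, fun x hx => (hinner x hx _).2 (hY x hx),
        hA.isItoIntegral (hw _) ht hts hsT hYM hY hX⟩

lemma MemS2.exists_isAdaptedCurve {ξ : ℝ → Ω → ℝ} {a b : ℝ} (hξ : MemS2 P 𝓕 a b ξ) :
    ∃ B, IsAdaptedCurve P 𝓕 a b B ∧ ∀ s ∈ Icc a b, ξ s =ᵐ[P] B s := by
  have h : ∀ s ∈ Icc a b, ∃ x : Lp ℝ 2 P, ξ s =ᵐ[P] x := fun s hs =>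
    ⟨(hξ.memLp s hs).toLp, (hξ.memLp s hs).coeFn_toLp.symm⟩
  choose! B hB using h
  refine ⟨B, ⟨fun s hs => ?_, fun s hs => ?_⟩, hB⟩
  · rw [ContinuousWithinAt, tendsto_iff_enorm_sub]
    refine (hξ.ms_continuous s hs).congr' ?_
    filter_upwards [eventually_mem_nhdsWithin] with x hx
    refine eLpNorm_eq_enorm ?_
    filter_upwards [hB x hx, hB s hs, Lp.coeFn_sub (B x) (B s)] with ω h1 h2 h3
    rw [h3, Pi.sub_apply, h1, h2]
  · rw [mem_lpMeas_iff_aestronglyMeasurable]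
    exact (hξ.adapted s hs).stronglyMeasurable.aestronglyMeasurable.congr (hB s hs)

end Iterated

/-! ### Assembly for the given integrators -/

/-- A single constant dominates both the `1` of a Wiener process and the `T` of time, as an iterated
integral may mix them. -/
lemma isL2Integrator_integrator {P : Measure Ω} [IsProbabilityMeasure P] {𝓕 : Filtration ℝ mΩ}
    {T : ℝ} {m : ℕ} {f : Fin m → ℝ → Ω → ℝ} (hf : ∀ i, IsWiener P 𝓕 T (f i))
    (j : Fin (m + 1)) : IsL2Integrator P 𝓕 T (1 + T.toNNReal) (integrator f j) := by
  induction j using Fin.cases with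
  | zero =>
    refine isL2Integrator_time ?_
    push_cast
    linarith [Real.le_coe_toNNReal T]
  | succ j => exact (hf j).isL2Integrator le_self_add

end IterIto

end

theorem theorem2 {Ω : Type*} {mΩ : MeasurableSpace Ω} (P : Measure Ω) [IsProbabilityMeasure P]
    (𝓕 : Filtration ℝ mΩ) (t T : ℝ) (ht : 0 ≤ t) (htT : t < T)
    (m : ℕ) (f : Fin m → ℝ → Ω → ℝ) (hf : ∀ i, IterIto.IsWiener P 𝓕 T (f i))
    (hindep : iIndepFun (fun i ω (s : Icc (0 : ℝ) T) => f i s ω) P)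
    (ξ : ℝ → Ω → ℝ) (hξ : IterIto.MemS2 P 𝓕 t T ξ)
    -- the multiplicity is `k = n + 2 ≥ 2`, and `Φ` has `k - 1 = n + 1` variables
    (n : ℕ) (i : Fin (n + 2) → Fin (m + 1))
    (Φ : (Fin (n + 1) → ℝ) → ℝ) (hΦ : ContinuousOn Φ (IterIto.simplex (n + 1) t T)) :
    -- the iterated Ito integral exists
    (∃ X, IterIto.IsIteratedIto P 𝓕 (IterIto.integrator f) ξ t (n + 1) i Φ T X) ∧
    -- the order-replaced integral exists
    (∃ X, IterIto.IsOrderReplacedWith P 𝓕 (IterIto.integrator f) ξ t T n i Φ X) ∧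
    -- and they are almost surely equal
    (∀ X X', IterIto.IsIteratedIto P 𝓕 (IterIto.integrator f) ξ t (n + 1) i Φ T X →
      IterIto.IsOrderReplacedWith P 𝓕 (IterIto.integrator f) ξ t T n i Φ X' →
      X =ᵐ[P] X') := by
  have hw := IterIto.isL2Integrator_integrator hf
  obtain ⟨B, hB, hξB⟩ := hξ.exists_isAdaptedCurve
  have h1 := fun X => IterIto.isIteratedIto_iff hw (i := i) (X := X) ht htT.le le_rfl hΦ
    hξ.toMemM2 hB hξB
  have h2 := fun X => IterIto.isOrderReplacedWith_iff hw (i := i) (X := X) ht htT.le hΦ hB hξB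
  exact ⟨⟨_, (h1 _).2 (EventuallyEq.refl _ _)⟩, ⟨_, (h2 _).2 (EventuallyEq.refl _ _)⟩,
    fun X X' hX hX' => ((h1 X).1 hX).trans ((h2 X').1 hX').symm⟩
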